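/- Let $H$ and $U$ be two Hilbert spaces over the same field $\mathbb K=\mathbb R$ or $\mathbb C$. Let $A_0:D(A_0)\subset H\to H$ be the generator of a $C_0$-semigroup on $H$, let $B\in\mathcal L(U,D(A_0^*)')$ (dual with respect to the pivot space $H$), and let $\mathcal K\in\mathcal L(H)$ be compact. Put $A_{\mathcal K}=A_0+\mathcal K$ with $D(A_{\mathcal K})=D(A_0)$, so that $D(A_{\mathcal K}^*)=D(A_0^*)$. For the generator $A$ of a $C_0$-semigroup $(S_A(t))_{t\ge0}$ and $B\in\mathcal L(U,D(A^*)')$, $B$ is called admissible for $A$ if for every $T>0$ there is $C>0$ such that $$\int_0^T\|B^*S_A(t)^*z\|_U^2\,dt\le C\|z\|_H^2\qquad\text{for all } z\in D(A^*).$$ In this case, for $y^0\in H$ and $u\in L^2(0,T;U)$, the solution (by transposition) of $y'=Ay+Bu$, $y(0)=y^0$, is the unique $y\in C^0([0,T];H)$ with $$\langle y(\tau),z\rangle_H=\langle y^0,S_A(\tau)^*z\rangle_H+\int_0^\tau\langle u(t),B^*S_A(\tau-t)^*z\rangle_U\,dt\qquad\text{for all }\tau\in[0,T],\ z\in D(A^*).$$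 The pair $(A,B)$ is exactly controllable in time $T$ if for all $y^0,y^1\in H$ there is $u\in L^2(0,T;U)$ whose solution satisfies $y(T)=y^1$; it is approximately controllable in time $T$ if for all $\varepsilon>0$ and $y^0,y^1\in H$ there is $u\in L^2(0,T;U)$ whose solution satisfies $\|y(T)-y^1\|_H\le\varepsilon$. **Theorem.** Assume that $B$ is admissible for $A_0$ and that $(A_0,B)$ is exactly controllable in some time $T^*>0$. Then $A_{\mathcal K}$ generates a $C_0$-semigroup on $H$ and $B$ is admissible for $A_{\mathcal K}$; and if $(A_{\mathcal K},B)$ is approximately controllable in time $T^*$, then $(A_{\mathcal K},B)$ is exactly controllable in the same time $T^*$. -/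

import Mathlib

set_option linter.unusedSectionVars false

open MeasureTheory Filter Topology
open scoped NNReal InnerProductSpace

/-- A `C₀`-semigroup (strongly continuous semigroup of bounded linear operators) on `H`. -/
structure C0Semigroup (𝕜 H : Type*) [RCLike 𝕜] [NormedAddCommGroup H] [InnerProductSpace 𝕜 H] where
  toFun : ℝ≥0 → H →L[𝕜] H
  map_zero : toFun 0 = ContinuousLinearMap.id 𝕜 H
  map_add : ∀ s t, toFun (s + t) = (toFun s).comp (toFun t)
  tendsto_zero : ∀ x, Tendsto (fun t => toFun t x) (𝓝 0) (𝓝 x)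

namespace Control

variable {𝕜 H U : Type*} [RCLike 𝕜]
  [NormedAddCommGroup H] [InnerProductSpace 𝕜 H] [CompleteSpace H]
  [NormedAddCommGroup U] [InnerProductSpace 𝕜 U] [CompleteSpace U]

/-- The unbounded operator `A` is the infinitesimal generator of the semigroup `S`:
`x ∈ D(A)` and `A x = y` if and only if `(S(t) x - x) / t → y` as `t → 0⁺`. -/
def IsGenerator (A : H →ₗ.[𝕜] H) (S : C0Semigroup 𝕜 H) : Prop :=
  ∀ x y : H, (x, y) ∈ A.graph ↔
    Tendsto (fun t : ℝ≥0 => (((t : ℝ) : 𝕜))⁻¹ • (S.toFun t x - x)) (𝓝[>] 0) (𝓝 y)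

/-- `D(A*)` with its graph norm, realised as the graph of the Hilbert space adjoint `A*`: its
elements are the pairs `(z, w)` with `⟪x, w⟫ = ⟪A x, z⟫` for all `x ∈ D(A)`, that is, when `A` is
densely defined (as every generator is), the pairs `(z, A* z)` with `z ∈ D(A*)`. The norm is the one
of `H × H`, `max ‖z‖ ‖A* z‖`. -/
noncomputable abbrev AdjDom (A : H →ₗ.[𝕜] H) : Submodule 𝕜 (H × H) := A.graph.adjoint

/-- `L(U, D(A*)')`. Here `D(A*)'` is the dual with respect to the pivot space `H`, that is, the
space of bounded conjugate-linear functionals on `D(A*)`, in which `H` embeds linearly by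
`y ↦ (z ↦ ⟪z, y⟫)` (Mathlib's inner product is conjugate-linear in its first argument). -/
abbrev ControlOp (A : H →ₗ.[𝕜] H) (U : Type*) [NormedAddCommGroup U] [InnerProductSpace 𝕜 U] :=
  U →L[𝕜] (AdjDom A →L⋆[𝕜] 𝕜)

/-- The adjoint `B* ∈ L(D(A*), U)` of a control operator. -/
noncomputable def ControlOp.dual {A : H →ₗ.[𝕜] H} (B : ControlOp A U) : AdjDom A →L[𝕜] U :=
  ((InnerProductSpace.toDual 𝕜 U).symm.toContinuousLinearEquiv :
    StrongDual 𝕜 U →L⋆[𝕜] U).comp B.flip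

/-- The defining relation of `B*`: `⟨B* z, u⟩_U = ⟨z, B u⟩`. -/
theorem ControlOp.inner_dual {A : H →ₗ.[𝕜] H} (B : ControlOp A U) (z : AdjDom A) (u : U) :
    ⟪ControlOp.dual B z, u⟫_𝕜 = B u z := by
  simp [ControlOp.dual]

theorem IsGenerator.map_mem {A : H →ₗ.[𝕜] H} {S : C0Semigroup 𝕜 H} (h : IsGenerator A S)
    (t : ℝ≥0) {x y : H} (hxy : (x, y) ∈ A.graph) : (S.toFun t x, S.toFun t y) ∈ A.graph := by
  rw [h] at hxy ⊢
  refine (((S.toFun t).continuous.tendsto y).comp hxy).congr fun s => ?_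
  have : S.toFun s (S.toFun t x) = S.toFun t (S.toFun s x) := by
    rw [← ContinuousLinearMap.comp_apply, ← ContinuousLinearMap.comp_apply, ← S.map_add,
      ← S.map_add, add_comm]
  simp [this]

/-- `S(t)*` maps `D(A*)` into itself, and `A* S(t)* z = S(t)* A* z` there. -/
theorem IsGenerator.adjoint_mem {A : H →ₗ.[𝕜] H} {S : C0Semigroup 𝕜 H} (h : IsGenerator A S)
    (t : ℝ≥0) (z : AdjDom A) :
    ((S.toFun t).adjoint z.1.1, (S.toFun t).adjoint z.1.2) ∈ AdjDom A := by
  rw [Submodule.mem_adjoint_iff]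
  intro a b hab
  have := (Submodule.mem_adjoint_iff _ _).1 z.2 _ _ (h.map_mem t hab)
  simpa [ContinuousLinearMap.adjoint_inner_right] using this

/-- The restriction of `S(t)*` to `D(A*)`. -/
noncomputable def adjFlow {A : H →ₗ.[𝕜] H} {S : C0Semigroup 𝕜 H} (h : IsGenerator A S) (t : ℝ≥0)
    (z : AdjDom A) : AdjDom A :=
  ⟨((S.toFun t).adjoint z.1.1, (S.toFun t).adjoint z.1.2), h.adjoint_mem t z⟩

/-- The function `t ↦ B* S(t)* z` for `z ∈ D(A*)`; only times `t ≥ 0` are relevant. -/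
noncomputable def observe {A : H →ₗ.[𝕜] H} {S : C0Semigroup 𝕜 H} (h : IsGenerator A S)
    (B : ControlOp A U) (z : AdjDom A) (t : ℝ) : U :=
  ControlOp.dual B (adjFlow h t.toNNReal z)

/-- `B` is admissible for `A`. (For `z ∈ D(A*)` the integrand is continuous.) -/
def IsAdmissible {A : H →ₗ.[𝕜] H} {S : C0Semigroup 𝕜 H} (h : IsGenerator A S)
    (B : ControlOp A U) : Prop :=
  ∀ T : ℝ, 0 < T → ∃ C : ℝ, 0 < C ∧ ∀ z : AdjDom A,
    ∫ t in (0 : ℝ)..T, ‖observe h B z t‖ ^ 2 ≤ C * ‖z.1.1‖ ^ 2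

/-- `y ∈ C⁰([0,T]; H)` is the solution by transposition of `y' = A y + B u`, `y(0) = y⁰`:
for all `τ ∈ [0,T]` and `z ∈ D(A*)`,
`⟨y(τ), z⟩ = ⟨y⁰, S(τ)* z⟩ + ∫₀^τ ⟨u(t), B* S(τ-t)* z⟩ dt`. -/
structure IsSolution {A : H →ₗ.[𝕜] H} {S : C0Semigroup 𝕜 H} (h : IsGenerator A S)
    (B : ControlOp A U) (T : ℝ) (y₀ : H) (u : ℝ → U) (y : ℝ → H) : Prop where
  continuousOn : ContinuousOn y (Set.Icc 0 T)
  transposition : ∀ τ ∈ Set.Icc 0 T, ∀ z : AdjDom A,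
    ⟪z.1.1, y τ⟫_𝕜 = ⟪(S.toFun τ.toNNReal).adjoint z.1.1, y₀⟫_𝕜 +
      ∫ t in (0 : ℝ)..τ, ⟪observe h B z (τ - t), u t⟫_𝕜

/-- `(A, B)` is exactly controllable in time `T`. -/
def ExactlyControllable {A : H →ₗ.[𝕜] H} {S : C0Semigroup 𝕜 H} (h : IsGenerator A S)
    (B : ControlOp A U) (T : ℝ) : Prop :=
  ∀ y₀ y₁ : H, ∃ u : ℝ → U, MemLp u 2 (volume.restrict (Set.Ioo 0 T)) ∧
    ∃ y : ℝ → H, IsSolution h B T y₀ u y ∧ y T = y₁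

/-- `(A, B)` is approximately controllable in time `T`. -/
def ApproximatelyControllable {A : H →ₗ.[𝕜] H} {S : C0Semigroup 𝕜 H} (h : IsGenerator A S)
    (B : ControlOp A U) (T : ℝ) : Prop :=
  ∀ ε : ℝ, 0 < ε → ∀ y₀ y₁ : H, ∃ u : ℝ → U, MemLp u 2 (volume.restrict (Set.Ioo 0 T)) ∧
    ∃ y : ℝ → H, IsSolution h B T y₀ u y ∧ ‖y T - y₁‖ ≤ ε

/-- The operator `A + K` with domain `D(A + K) = D(A)`. -/
def perturb (A : H →ₗ.[𝕜] H) (K : H →L[𝕜] H) : H →ₗ.[𝕜] H := (K : H →ₗ[𝕜] H) +ᵥ A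

theorem sub_adjoint_mem {A : H →ₗ.[𝕜] H} {K : H →L[𝕜] H} (z : AdjDom (perturb A K)) :
    (z.1.1, z.1.2 - K.adjoint z.1.1) ∈ AdjDom A := by
  rw [Submodule.mem_adjoint_iff]
  intro a b hab
  obtain ⟨x, rfl, rfl⟩ := (LinearPMap.mem_graph_iff A).1 hab
  have hz := (Submodule.mem_adjoint_iff _ _).1 z.2 _ _ ((perturb A K).mem_graph x)
  have e : perturb A K x = K x + A x := rfl
  rw [e, inner_add_left] at hz
  rw [inner_sub_right, ContinuousLinearMap.adjoint_inner_right]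
  linear_combination hz

/-- The identity map `D((A + K)*) → D(A*)`, `z ↦ z` (in graphs: `A* z = (A + K)* z - K* z`). -/
noncomputable def adjDomInclusion (A : H →ₗ.[𝕜] H) (K : H →L[𝕜] H) :
    AdjDom (perturb A K) →L[𝕜] AdjDom A :=
  (((ContinuousLinearMap.fst 𝕜 H H).prod
    (ContinuousLinearMap.snd 𝕜 H H - K.adjoint.comp (ContinuousLinearMap.fst 𝕜 H H))).comp
      (AdjDom (perturb A K)).subtypeL).codRestrict (AdjDom A) sub_adjoint_mem

/-- `B ∈ L(U, D(A*)')` regarded as an element of `L(U, D((A + K)*)')`, through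
`D((A + K)*) = D(A*)`. -/
noncomputable def ControlOp.perturb {A : H →ₗ.[𝕜] H} (B : ControlOp A U) (K : H →L[𝕜] H) :
    ControlOp (Control.perturb A K) U :=
  (ContinuousLinearMap.precomp 𝕜 (adjDomInclusion A K)).comp B

theorem ControlOp.perturb_apply {A : H →ₗ.[𝕜] H} (B : ControlOp A U) (K : H →L[𝕜] H) (u : U)
    (z : AdjDom (Control.perturb A K)) :
    ControlOp.perturb B K u z = B u (adjDomInclusion A K z) := rfl

end Control

/-! The proof is by duality. Admissibility extends `z ↦ B* S(·)* z` to a bounded observation map `Ψ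
: H → L²(0, T; U)` (`obsCLM`). The state at time `T` is `S(T) y⁰ + Ψ* v`, where `v` is the
time-reversed control. Hence exact controllability means that `Ψ*` is surjective, equivalently that
`‖z‖ ≤ C ‖Ψ z‖`, and approximate controllability makes `Ψ` injective.

Let `S₁` be the perturbed semigroup and `Ψ₁` its observation map. Variation of constants for the
adjoints reads `S₁(t)* z = S(t)* z + ∫₀ᵗ S(t-s)* K* S₁(s)* z ds`. Applying `B*` gives `Ψ₁ = Ψ + D`
with `D z = ∫₀ᵀ τ_s Ψ K* S₁(s)* z ds`, where `τ_s` is the right shift by `s` (`observeLin_perturb`).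
This formula yields admissibility, and `D` is compact because `K*` is (`isCompactOperator_obsDiff`).
So `Ψ₁` is an injective compact perturbation of an operator bounded from below, hence is itself
bounded from below, and `Ψ₁*` is surjective.

The delicate point is moving `B*` under the integral, since `K* S₁(s)* z` need not lie in `D(A*)`.
The adjoints of the averages `ε⁻¹ ∫₀^ε S(s) ds` map `H` boundedly into `D(A*)` and commute with the
adjoint flow. The identity is proved after this regularization, where `B*` becomes a bounded
operator and Fubini applies, and then `ε → 0`.

The perturbed semigroup itself comes from a Neumann series for Duhamel's equation on bounded
functions, after an exponential rescaling. -/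

namespace C0Semigroup

variable {𝕜 H : Type*} [RCLike 𝕜] [NormedAddCommGroup H] [InnerProductSpace 𝕜 H] [CompleteSpace H]
  (S : C0Semigroup 𝕜 H)

/-! ### Growth bounds and joint continuity of a semigroup. -/

theorem add_apply (s t : ℝ≥0) (x : H) : S.toFun (s + t) x = S.toFun s (S.toFun t x) := by
  rw [S.map_add]; rfl

theorem zero_apply (x : H) : S.toFun 0 x = x := by
  rw [S.map_zero]; rfl

/-- Otherwise some `t n → 0` has `‖S(t n)‖ > n`, while each orbit `S(t n) x` converges: this
contradicts the uniform boundedness principle. -/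
theorem exists_bound_near_zero : ∃ δ : ℝ≥0, 0 < δ ∧ ∃ M : ℝ, ∀ t ≤ δ, ‖S.toFun t‖ ≤ M := by
  by_contra! hcon
  have hpos : ∀ n : ℕ, (0 : ℝ≥0) < 1 / ((n : ℝ≥0) + 1) := fun n => by positivity
  choose t ht hM using fun n : ℕ => hcon _ (hpos n) n
  have ht0 : Tendsto t atTop (𝓝 0) :=
    tendsto_of_tendsto_of_tendsto_of_le_of_le tendsto_const_nhds
      tendsto_one_div_add_atTop_nhds_zero_nat (fun _ => zero_le) ht
  obtain ⟨C, hC⟩ := banach_steinhaus (g := fun n => S.toFun (t n)) fun x => by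
    obtain ⟨C, hC⟩ := ((S.tendsto_zero x).comp ht0).norm.bddAbove_range
    exact ⟨C, fun n => hC ⟨n, rfl⟩⟩
  obtain ⟨n, hn⟩ := exists_nat_gt C
  exact absurd (hM n) (not_lt.2 ((hC n).trans hn.le))

theorem exists_growth_bound :
    ∃ M ω : ℝ, 1 ≤ M ∧ 0 ≤ ω ∧ ∀ t : ℝ≥0, ‖S.toFun t‖ ≤ M * Real.exp (ω * t) := by
  obtain ⟨δ, hδ, M₀, hM₀⟩ := S.exists_bound_near_zero
  set M := max M₀ 1
  have hM1 : 1 ≤ M := le_max_right _ _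
  have hM : ∀ t ≤ δ, ‖S.toFun t‖ ≤ M := fun t ht => (hM₀ t ht).trans (le_max_left _ _)
  -- Each further step of length `δ` costs one factor `M`; taking `n = ⌊t / δ⌋` then gives `ω = log
  -- M / δ`.
  have key : ∀ n : ℕ, ∀ t : ℝ≥0, t ≤ (n + 1) * δ → ‖S.toFun t‖ ≤ M ^ (n + 1) := by
    intro n
    induction n with
    | zero => intro t ht; simpa using hM t (by simpa using ht)
    | succ n ih =>
      intro t ht
      rcases le_total t δ with h | h
      · exact (hM t h).trans (le_self_pow₀ hM1 (by omega))
      · obtain ⟨s, rfl⟩ := exists_add_of_le h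
        rw [S.map_add]
        refine (ContinuousLinearMap.opNorm_comp_le _ _).trans ?_
        rw [pow_succ']
        refine mul_le_mul (hM _ le_rfl) (ih s ?_) (norm_nonneg _) (by positivity)
        have : δ + s ≤ δ + (n + 1) * δ := by
          refine ht.trans (le_of_eq ?_); push_cast; ring
        exact le_of_add_le_add_left this
  refine ⟨M, Real.log M / δ, hM1, div_nonneg (Real.log_nonneg hM1) δ.2, fun t => ?_⟩
  have hδ' : (0 : ℝ) < δ := hδ
  set n := ⌊(t / δ : ℝ)⌋₊
  have h1 : (n : ℝ) ≤ t / δ := Nat.floor_le (by positivity)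
  have h2 : (t / δ : ℝ) < n + 1 := Nat.lt_floor_add_one _
  have h3 : ‖S.toFun t‖ ≤ M ^ (n + 1) := by
    refine key n t ?_
    rw [← NNReal.coe_le_coe]
    push_cast
    exact ((div_lt_iff₀ hδ').1 h2).le
  refine h3.trans ?_
  rw [pow_succ']
  refine mul_le_mul_of_nonneg_left ?_ (by positivity)
  have : Real.log M / δ * t = Real.log M * (t / δ) := by ring
  rw [this, ← Real.rpow_def_of_pos (by positivity), ← Real.rpow_natCast]
  exact Real.rpow_le_rpow_of_exponent_le hM1 h1

theorem exists_bound_le (T : ℝ≥0) : ∃ M : ℝ, 0 < M ∧ ∀ t ≤ T, ‖S.toFun t‖ ≤ M := by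
  obtain ⟨M, ω, hM, hω, h⟩ := S.exists_growth_bound
  refine ⟨M * Real.exp (ω * T), by positivity, fun t ht => (h t).trans ?_⟩
  gcongr

/-- Factoring out the semigroup at the smaller time reduces continuity everywhere to continuity at
`0`. The sum of the two norms keeps the bound symmetric in `s` and `t`. -/
theorem norm_sub_apply_le (s t : ℝ≥0) (x : H) :
    ‖S.toFun t x - S.toFun s x‖ ≤
      (‖S.toFun s‖ + ‖S.toFun t‖) * ‖S.toFun (nndist t s) x - x‖ := by
  wlog hst : s ≤ t generalizing s t with hw
  · rw [norm_sub_rev, add_comm, nndist_comm]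
    exact hw t s (le_of_not_ge hst)
  obtain ⟨r, rfl⟩ := exists_add_of_le hst
  have hr : nndist (s + r) s = r := by
    ext; simp [coe_nndist, NNReal.dist_eq]
  rw [hr, S.add_apply, ← map_sub]
  refine ((S.toFun s).le_opNorm _).trans ?_
  gcongr
  simp

theorem continuous_apply (x : H) : Continuous fun t => S.toFun t x := by
  rw [continuous_iff_continuousAt]
  intro s
  obtain ⟨M, hM0, hM⟩ := S.exists_bound_le (s + 1)
  rw [ContinuousAt, tendsto_iff_norm_sub_tendsto_zero]
  have h0 : Tendsto (fun t : ℝ≥0 => nndist t s) (𝓝 s) (𝓝 0) := by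
    have : Continuous fun t : ℝ≥0 => nndist t s := by fun_prop
    simpa using this.tendsto s
  have h1 : Tendsto (fun t : ℝ≥0 => (M + M) * ‖S.toFun (nndist t s) x - x‖) (𝓝 s) (𝓝 0) := by
    have := ((((S.tendsto_zero x).comp h0).sub_const x).norm).const_mul (M + M)
    simpa using this
  refine squeeze_zero' (Eventually.of_forall fun _ => norm_nonneg _) ?_ h1
  have : ∀ᶠ t in 𝓝 s, t ≤ s + 1 := by
    filter_upwards [eventually_lt_nhds (lt_add_one s)] with t ht using ht.le
  filter_upwards [this] with t ht
  refine (S.norm_sub_apply_le s t x).trans ?_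
  gcongr
  · exact hM _ (by simp)
  · exact hM _ ht

theorem continuous_uncurry : Continuous fun p : ℝ≥0 × H => S.toFun p.1 p.2 := by
  rw [continuous_iff_continuousAt]
  rintro ⟨s, x⟩
  obtain ⟨M, hM0, hM⟩ := S.exists_bound_le (s + 1)
  rw [ContinuousAt, tendsto_iff_norm_sub_tendsto_zero]
  have h1 : Tendsto (fun p : ℝ≥0 × H => M * ‖p.2 - x‖ + ‖S.toFun p.1 x - S.toFun s x‖)
      (𝓝 (s, x)) (𝓝 0) := by
    have : Continuous fun p : ℝ≥0 × H => M * ‖p.2 - x‖ + ‖S.toFun p.1 x - S.toFun s x‖ := by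
      have := (S.continuous_apply x).comp (continuous_fst (X := ℝ≥0) (Y := H))
      simp only [Function.comp_def] at this
      fun_prop
    simpa using this.tendsto (s, x)
  refine squeeze_zero' (Eventually.of_forall fun _ => norm_nonneg _) ?_ h1
  have : ∀ᶠ p : ℝ≥0 × H in 𝓝 (s, x), p.1 ≤ s + 1 := by
    have h := (continuous_fst (X := ℝ≥0) (Y := H)).tendsto (s, x)
    filter_upwards [h.eventually (eventually_lt_nhds (lt_add_one s))] with t ht using ht.le
  filter_upwards [this] with p hp
  calc ‖S.toFun p.1 p.2 - S.toFun s x‖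
      = ‖S.toFun p.1 (p.2 - x) + (S.toFun p.1 x - S.toFun s x)‖ := by rw [map_sub]; congr 1; abel
    _ ≤ ‖S.toFun p.1 (p.2 - x)‖ + ‖S.toFun p.1 x - S.toFun s x‖ := norm_add_le _ _
    _ ≤ _ := by
      gcongr
      refine ((S.toFun p.1).le_opNorm _).trans ?_
      gcongr
      exact hM _ hp

@[fun_prop]
theorem continuous_comp {Y : Type*} [TopologicalSpace Y] {f : Y → ℝ} {g : Y → H}
    (hf : Continuous f) (hg : Continuous g) :
    Continuous fun y => S.toFun (f y).toNNReal (g y) :=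
  S.continuous_uncurry.comp ((continuous_real_toNNReal.comp hf).prodMk hg)

end C0Semigroup

/-! ### Integrals of strongly continuous operator families. -/

section StrongIntegral

variable {𝕜 E F : Type*} [RCLike 𝕜] [NormedAddCommGroup E] [NormedSpace 𝕜 E] [CompleteSpace E]
  [NormedAddCommGroup F] [NormedSpace 𝕜 F]

theorem exists_opNorm_bound_of_isCompact {Y : Type*} [TopologicalSpace Y] {G : Y → E →L[𝕜] F}
    (hG : ∀ x, Continuous fun y => G y x) {s : Set Y} (hs : IsCompact s) :
    ∃ M : ℝ, 0 < M ∧ ∀ y ∈ s, ‖G y‖ ≤ M := by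
  obtain ⟨C, hC⟩ := banach_steinhaus (g := fun y : s => G y) fun x => by
    obtain ⟨C, hC⟩ := hs.exists_bound_of_continuousOn (hG x).continuousOn
    exact ⟨C, fun y => hC y y.2⟩
  exact ⟨max C 1, by positivity, fun y hy => (hC ⟨y, hy⟩).trans (le_max_left _ _)⟩

variable [NormedSpace ℝ F] [IsScalarTower ℝ 𝕜 F]

/-- The integral over `[a, b]` of a strongly continuous family of operators. -/
noncomputable def strongIntegral (G : ℝ → E →L[𝕜] F) (hG : ∀ x, Continuous fun s => G s x)
    (a b : ℝ) : E →L[𝕜] F :=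
  LinearMap.mkContinuousOfExistsBound
    { toFun := fun x => ∫ s in a..b, G s x
      map_add' := fun x y => by
        simp only [map_add]
        exact intervalIntegral.integral_add ((hG x).intervalIntegrable _ _)
          ((hG y).intervalIntegrable _ _)
      map_smul' := fun c x => by
        simp only [map_smul, RingHom.id_apply]
        exact intervalIntegral.integral_smul c _ }
    (by
      obtain ⟨M, hM0, hM⟩ := exists_opNorm_bound_of_isCompact hG (isCompact_uIcc (a := a) (b := b))
      refine ⟨M * |b - a|, fun x => ?_⟩
      have := intervalIntegral.norm_integral_le_of_norm_le_const (a := a) (b := b)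
        (f := fun s => G s x) (C := M * ‖x‖) fun s hs =>
          ((G s).le_opNorm x).trans (by gcongr; exact hM s (Set.uIoc_subset_uIcc hs))
      calc _ ≤ _ := this
        _ = _ := by ring)

@[simp]
theorem strongIntegral_apply (G : ℝ → E →L[𝕜] F) (hG : ∀ x, Continuous fun s => G s x)
    (a b : ℝ) (x : E) : strongIntegral G hG a b x = ∫ s in a..b, G s x := rfl

end StrongIntegral

/-! ### Averages of a semigroup and strong continuity of the adjoints. -/

namespace C0Semigroup

variable {𝕜 H : Type*} [RCLike 𝕜] [NormedAddCommGroup H] [InnerProductSpace 𝕜 H] [CompleteSpace H]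
  [NormedSpace ℝ H] [IsScalarTower ℝ 𝕜 H] (S : C0Semigroup 𝕜 H)

theorem add_toNNReal_apply {s t : ℝ} (hs : 0 ≤ s) (ht : 0 ≤ t) (x : H) :
    S.toFun (s + t).toNNReal x = S.toFun s.toNNReal (S.toFun t.toNNReal x) := by
  rw [Real.toNNReal_add hs ht, S.add_apply]

theorem commute_apply (s t : ℝ≥0) (x : H) :
    S.toFun s (S.toFun t x) = S.toFun t (S.toFun s x) := by
  rw [← S.add_apply, add_comm, S.add_apply]

theorem exists_bound_Icc (a b : ℝ) :
    ∃ M : ℝ, 0 < M ∧ ∀ t ∈ Set.Icc a b, ‖S.toFun t.toNNReal‖ ≤ M :=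
  exists_opNorm_bound_of_isCompact (fun _ => S.continuous_comp continuous_id continuous_const)
    isCompact_Icc

/-- The mean value of the semigroup over `[0, ε]`. -/
noncomputable def avg (ε : ℝ) : H →L[𝕜] H :=
  ((ε⁻¹ : ℝ) : 𝕜) • strongIntegral (fun s : ℝ => S.toFun s.toNNReal)
    (fun _ => S.continuous_comp continuous_id continuous_const) 0 ε

theorem avg_apply (ε : ℝ) (x : H) : S.avg ε x = ε⁻¹ • ∫ s in (0 : ℝ)..ε, S.toFun s.toNNReal x := by
  simp [avg, RCLike.real_smul_eq_coe_smul (K := 𝕜)]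

theorem tendsto_avg (x : H) : Tendsto (fun ε => S.avg ε x) (𝓝[>] 0) (𝓝 x) := by
  have hc : Continuous fun s : ℝ => S.toFun s.toNNReal x :=
    S.continuous_comp continuous_id continuous_const
  have := (intervalIntegral.integral_hasDerivAt_right (hc.intervalIntegrable 0 0)
    (hc.stronglyMeasurableAtFilter _ _) hc.continuousAt).hasDerivWithinAt (s := Set.Ioi 0)
  simp only [Real.toNNReal_zero, S.zero_apply] at this
  rw [hasDerivWithinAt_iff_tendsto_slope' (by simp)] at this
  refine this.congr fun ε => ?_
  simp [slope_def_module, avg_apply]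

theorem norm_avg_le {T M : ℝ} (hM : ∀ t ∈ Set.Icc 0 T, ‖S.toFun t.toNNReal‖ ≤ M) {ε : ℝ}
    (hε : 0 < ε) (hεT : ε ≤ T) (x : H) : ‖S.avg ε x‖ ≤ M * ‖x‖ := by
  rw [avg_apply, norm_smul, Real.norm_eq_abs, abs_of_pos (inv_pos.2 hε)]
  have := intervalIntegral.norm_integral_le_of_norm_le_const (a := 0) (b := ε)
    (f := fun s : ℝ => S.toFun s.toNNReal x) (C := M * ‖x‖) fun s hs => by
      rw [Set.uIoc_of_le hε.le] at hs
      exact ((S.toFun _).le_opNorm x).trans (by gcongr; exact hM s ⟨hs.1.le, hs.2.trans hεT⟩)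
  calc _ ≤ ε⁻¹ * (M * ‖x‖ * |ε - 0|) := by gcongr
    _ = _ := by rw [sub_zero, abs_of_pos hε]; field_simp

theorem avg_commute (ε : ℝ) (t : ℝ≥0) (x : H) : S.avg ε (S.toFun t x) = S.toFun t (S.avg ε x) := by
  rw [avg_apply, avg_apply, RCLike.real_smul_eq_coe_smul (K := 𝕜),
    RCLike.real_smul_eq_coe_smul (K := 𝕜), map_smul,
    ← ContinuousLinearMap.intervalIntegral_comp_comm]
  · simp only [S.commute_apply t]
  · exact (S.continuous_comp continuous_id continuous_const).intervalIntegrable _ _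

theorem apply_avg_sub {ε t : ℝ} (hε : 0 ≤ ε) (ht : 0 ≤ t) (x : H) :
    S.toFun t.toNNReal (S.avg ε x) - S.avg ε x =
      ε⁻¹ • ((∫ s in ε..(ε + t), S.toFun s.toNNReal x) - ∫ s in (0 : ℝ)..t, S.toFun s.toNNReal x) := by
  have hc : Continuous fun s : ℝ => S.toFun s.toNNReal x :=
    S.continuous_comp continuous_id continuous_const
  have h1 : ∫ s in (0 : ℝ)..ε, S.toFun s.toNNReal (S.toFun t.toNNReal x) =
      ∫ s in t..(ε + t), S.toFun s.toNNReal x := by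
    have := intervalIntegral.integral_comp_add_right (a := 0) (b := ε)
      (fun s : ℝ => S.toFun s.toNNReal x) t
    rw [zero_add] at this
    rw [← this]
    refine intervalIntegral.integral_congr fun s hs => ?_
    rw [Set.uIcc_of_le hε] at hs
    exact (S.add_toNNReal_apply hs.1 ht x).symm
  rw [← S.avg_commute, avg_apply, avg_apply, h1, ← smul_sub]
  congr 1
  have i := fun a b => hc.intervalIntegrable (μ := volume) a b
  rw [← intervalIntegral.integral_add_adjacent_intervals (i t ε) (i ε (ε + t)),
    ← intervalIntegral.integral_add_adjacent_intervals (i 0 t) (i t ε)]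
  abel

/-- The integrals over `[0, ε]` and `[t, ε + t]` differ only on two intervals of length `t`. The
resulting continuity is in operator norm, so unlike strong continuity it passes to adjoints. -/
theorem norm_avg_comp_sub_le {M ε t : ℝ} (hε : 0 < ε) (ht : 0 ≤ t) (ht1 : t ≤ 1)
    (hM : ∀ t ∈ Set.Icc 0 (ε + 1), ‖S.toFun t.toNNReal‖ ≤ M) (hM0 : 0 ≤ M) :
    ‖(S.avg ε).comp (S.toFun t.toNNReal) - S.avg ε‖ ≤ ε⁻¹ * (2 * M) * t := by
  refine ContinuousLinearMap.opNorm_le_bound _ (by positivity) fun x => ?_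
  rw [sub_apply, ContinuousLinearMap.comp_apply, avg_commute,
    S.apply_avg_sub hε.le ht, norm_smul, Real.norm_eq_abs, abs_of_pos (inv_pos.2 hε)]
  have key : ∀ a b : ℝ, 0 ≤ a → a ≤ b → b ≤ ε + 1 →
      ‖∫ s in a..b, S.toFun s.toNNReal x‖ ≤ M * ‖x‖ * (b - a) := by
    intro a b ha hab hb
    have := intervalIntegral.norm_integral_le_of_norm_le_const (a := a) (b := b)
      (f := fun s : ℝ => S.toFun s.toNNReal x) (C := M * ‖x‖) fun s hs => by
        rw [Set.uIoc_of_le hab] at hs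
        exact ((S.toFun _).le_opNorm x).trans
          (by gcongr; exact hM s ⟨ha.trans hs.1.le, hs.2.trans hb⟩)
    rwa [abs_of_nonneg (sub_nonneg.2 hab)] at this
  have k1 := key ε (ε + t) hε.le (by linarith) (by linarith)
  have k2 := key 0 t le_rfl ht (by linarith)
  calc _ ≤ ε⁻¹ * (M * ‖x‖ * (ε + t - ε) + M * ‖x‖ * (t - 0)) := by
        gcongr; exact (norm_sub_le _ _).trans (add_le_add k1 k2)
    _ = _ := by ring

theorem tendsto_adjoint_avg_adjoint {ε : ℝ} (hε : 0 < ε) (z : H) :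
    Tendsto (fun t => (S.toFun t).adjoint ((S.avg ε).adjoint z)) (𝓝 0)
      (𝓝 ((S.avg ε).adjoint z)) := by
  obtain ⟨M, hM0, hM⟩ := S.exists_bound_Icc 0 (ε + 1)
  rw [tendsto_iff_norm_sub_tendsto_zero]
  have h1 : Tendsto (fun t : ℝ≥0 => ε⁻¹ * (2 * M) * (t : ℝ) * ‖z‖) (𝓝 0) (𝓝 0) := by
    have : Continuous fun t : ℝ≥0 => ε⁻¹ * (2 * M) * (t : ℝ) * ‖z‖ := by fun_prop
    simpa using this.tendsto 0
  refine squeeze_zero' (Eventually.of_forall fun _ => norm_nonneg _) ?_ h1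
  filter_upwards [eventually_le_nhds (zero_lt_one' ℝ≥0)] with t ht
  have h2 := S.norm_avg_comp_sub_le hε t.2 ht hM hM0.le
  rw [← ContinuousLinearMap.adjoint.norm_map] at h2
  simp only [Real.toNNReal_coe, map_sub, ContinuousLinearMap.adjoint_comp, NNReal.val_eq_coe] at h2
  exact (((S.toFun t).adjoint.comp (S.avg ε).adjoint - (S.avg ε).adjoint).le_opNorm z).trans
    (by gcongr)

/-- The vectors with the desired limit form a subspace `V` containing the ranges of all `(S.avg
ε).adjoint`. A vector `x` orthogonal to `V` has `S.avg ε x = 0` for every `ε > 0`, hence `x = 0`. So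
`V` is dense, and the local bound on `‖S(t)‖` extends the limit to `H`. -/
theorem tendsto_adjoint (z : H) :
    Tendsto (fun t => (S.toFun t).adjoint z) (𝓝 0) (𝓝 z) := by
  let V : Submodule 𝕜 H :=
    { carrier := {z | Tendsto (fun t => (S.toFun t).adjoint z) (𝓝 0) (𝓝 z)}
      add_mem' := fun {a b} ha hb => by simpa using Tendsto.add ha hb
      zero_mem' := by simp
      smul_mem' := fun c x hx => by simpa using Tendsto.const_smul hx c }
  have hperp : Vᗮ = ⊥ := by
    rw [Submodule.eq_bot_iff]
    intro x hx
    have h0 : ∀ ε : ℝ, 0 < ε → S.avg ε x = 0 := by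
      intro ε hε
      refine ext_inner_left 𝕜 fun w => ?_
      rw [inner_zero_right, ← ContinuousLinearMap.adjoint_inner_left]
      exact (Submodule.mem_orthogonal _ _).1 hx _ (S.tendsto_adjoint_avg_adjoint hε w)
    refine tendsto_nhds_unique (S.tendsto_avg x) (tendsto_const_nhds.congr' ?_)
    filter_upwards [self_mem_nhdsWithin] with ε hε using (h0 ε hε).symm
  have hdense : Dense (V : Set H) :=
    (Submodule.dense_iff_topologicalClosure_eq_top).2
      ((Submodule.topologicalClosure_eq_top_iff).2 hperp)
  obtain ⟨M, hM0, hM⟩ := S.exists_bound_le 1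
  rw [Metric.tendsto_nhds]
  intro ε hε
  obtain ⟨v, hv, hvz⟩ := Metric.dense_iff.1 hdense z (ε / (2 * (M + 1))) (by positivity)
  rw [Metric.mem_ball, dist_eq_norm] at hv
  have h1 := (Metric.tendsto_nhds.1 (show Tendsto _ _ _ from hvz)) (ε / 2) (by positivity)
  filter_upwards [h1, eventually_le_nhds (zero_lt_one' ℝ≥0)] with t h1 ht
  rw [dist_eq_norm] at h1 ⊢
  calc ‖(S.toFun t).adjoint z - z‖
      = ‖((S.toFun t).adjoint v - v) - ((S.toFun t).adjoint (v - z) - (v - z))‖ := by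
        rw [map_sub]; congr 1; abel
    _ ≤ ‖(S.toFun t).adjoint v - v‖ + (M * ‖v - z‖ + ‖v - z‖) := by
        refine (norm_sub_le _ _).trans (add_le_add le_rfl ((norm_sub_le _ _).trans ?_))
        gcongr
        refine ((S.toFun t).adjoint.le_opNorm _).trans ?_
        gcongr
        rw [ContinuousLinearMap.adjoint.norm_map]
        exact hM t ht
    _ < ε / 2 + (M + 1) * (ε / (2 * (M + 1))) := by
        have : (M + 1) * ‖v - z‖ < (M + 1) * (ε / (2 * (M + 1))) := by gcongr
        linarith
    _ = ε := by field_simp; ring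

end C0Semigroup

/-! ### Inner products with integrals, and the adjoint semigroup. -/

section InnerIntegral

variable {𝕜 E : Type*} [RCLike 𝕜] [NormedAddCommGroup E] [InnerProductSpace 𝕜 E] [CompleteSpace E]
  [NormedSpace ℝ E]

theorem inner_intervalIntegral_right {f : ℝ → E} (hf : Continuous f) (a b : ℝ) (x : E) :
    ⟪x, ∫ s in a..b, f s⟫_𝕜 = ∫ s in a..b, ⟪x, f s⟫_𝕜 :=
  ((innerSL 𝕜 x).intervalIntegral_comp_comm (hf.intervalIntegrable a b)).symm

theorem inner_intervalIntegral_left {f : ℝ → E} (hf : Continuous f) (a b : ℝ) (x : E) :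
    ⟪∫ s in a..b, f s, x⟫_𝕜 = ∫ s in a..b, ⟪f s, x⟫_𝕜 := by
  have := (RCLike.conjCLE (K := 𝕜)).toContinuousLinearMap.intervalIntegral_comp_comm
    (f := fun s : ℝ => ⟪x, f s⟫_𝕜) (a := a) (b := b) (μ := volume)
    ((continuous_const.inner hf).intervalIntegrable _ _)
  rw [← inner_conj_symm, inner_intervalIntegral_right hf]
  simpa using this.symm

end InnerIntegral

namespace C0Semigroup

variable {𝕜 H : Type*} [RCLike 𝕜] [NormedAddCommGroup H] [InnerProductSpace 𝕜 H] [CompleteSpace H]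
  [NormedSpace ℝ H] [IsScalarTower ℝ 𝕜 H] (S : C0Semigroup 𝕜 H)

/-- The adjoint semigroup. -/
noncomputable def adjoint : C0Semigroup 𝕜 H where
  toFun t := (S.toFun t).adjoint
  map_zero := by rw [S.map_zero]; exact ContinuousLinearMap.adjoint_id
  map_add s t := by rw [add_comm, S.map_add, ContinuousLinearMap.adjoint_comp]
  tendsto_zero := S.tendsto_adjoint

@[simp]
theorem adjoint_toFun (t : ℝ≥0) : S.adjoint.toFun t = (S.toFun t).adjoint := rfl

theorem adjoint_avg (ε : ℝ) : (S.avg ε).adjoint = S.adjoint.avg ε := by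
  symm
  rw [ContinuousLinearMap.eq_adjoint_iff]
  intro x y
  have c : ∀ (S : C0Semigroup 𝕜 H) (x : H), Continuous fun s : ℝ => S.toFun s.toNNReal x :=
    fun S x => S.continuous_comp continuous_id continuous_const
  rw [avg_apply, avg_apply, RCLike.real_smul_eq_coe_smul (K := 𝕜),
    RCLike.real_smul_eq_coe_smul (K := 𝕜), inner_smul_left, inner_smul_right,
    inner_intervalIntegral_left (c S.adjoint x), inner_intervalIntegral_right (c S y)]
  simp [ContinuousLinearMap.adjoint_inner_left]

end C0Semigroup

/-! ### Generators and variation of constants. -/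

namespace Control

variable {𝕜 H : Type*} [RCLike 𝕜] [NormedAddCommGroup H] [InnerProductSpace 𝕜 H] [CompleteSpace H]
  [NormedSpace ℝ H] [IsScalarTower ℝ 𝕜 H]

theorem tendsto_coe_nhdsGT_zero : Tendsto ((↑) : ℝ≥0 → ℝ) (𝓝[>] 0) (𝓝[>] 0) :=
  tendsto_nhdsWithin_iff.2 ⟨(NNReal.continuous_coe.tendsto 0).mono_left nhdsWithin_le_nhds,
    by filter_upwards [self_mem_nhdsWithin] with t ht using ht⟩

theorem tendsto_toNNReal_nhdsGT_zero : Tendsto Real.toNNReal (𝓝[>] 0) (𝓝[>] 0) :=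
  tendsto_nhdsWithin_iff.2
    ⟨by simpa using (continuous_real_toNNReal.tendsto 0).mono_left nhdsWithin_le_nhds,
    by filter_upwards [self_mem_nhdsWithin] with t ht using Real.toNNReal_pos.2 ht⟩

/-- The generator in terms of difference quotients with real time. -/
theorem isGenerator_iff {A : H →ₗ.[𝕜] H} {S : C0Semigroup 𝕜 H} :
    IsGenerator A S ↔ ∀ x y : H, (x, y) ∈ A.graph ↔
      Tendsto (fun t : ℝ => t⁻¹ • (S.toFun t.toNNReal x - x)) (𝓝[>] 0) (𝓝 y) := by
  refine forall₂_congr fun x y => iff_congr Iff.rfl ⟨fun h => ?_, fun h => ?_⟩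
  · refine (h.comp tendsto_toNNReal_nhdsGT_zero).congr' ?_
    filter_upwards [self_mem_nhdsWithin] with t ht
    simp only [Function.comp_apply, Real.coe_toNNReal t (le_of_lt ht)]
    rw [RCLike.real_smul_eq_coe_smul (K := 𝕜), RCLike.ofReal_inv]
  · refine (h.comp tendsto_coe_nhdsGT_zero).congr fun t => ?_
    simp only [Function.comp_apply, Real.toNNReal_coe]
    rw [RCLike.real_smul_eq_coe_smul (K := 𝕜), RCLike.ofReal_inv]

theorem mem_graph_perturb {A : H →ₗ.[𝕜] H} {K : H →L[𝕜] H} {x y : H} :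
    (x, y) ∈ (perturb A K).graph ↔ (x, y - K x) ∈ A.graph := by
  simp only [LinearPMap.mem_graph_iff]
  constructor
  · rintro ⟨a, rfl, rfl⟩
    refine ⟨a, rfl, ?_⟩
    have e : perturb A K a = K a + A a := rfl
    rw [e]; abel
  · rintro ⟨a, rfl, ha⟩
    refine ⟨a, rfl, ?_⟩
    have e : perturb A K a = K a + A a := rfl
    rw [e, ha]; abel

variable {A : H →ₗ.[𝕜] H} {S : C0Semigroup 𝕜 H}

theorem IsGenerator.avg_mem (h : IsGenerator A S) {ε : ℝ} (hε : 0 < ε) (x : H) :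
    (S.avg ε x, ε⁻¹ • (S.toFun ε.toNNReal x - x)) ∈ A.graph := by
  rw [isGenerator_iff.1 h]
  have hc : Continuous fun s : ℝ => S.toFun s.toNNReal x :=
    S.continuous_comp continuous_id continuous_const
  have key : ∀ a : ℝ, Tendsto (fun t => t⁻¹ • ∫ s in a..(a + t), S.toFun s.toNNReal x) (𝓝[>] 0)
      (𝓝 (S.toFun a.toNNReal x)) := by
    intro a
    have h1 := (intervalIntegral.integral_hasDerivAt_right (hc.intervalIntegrable a a)
      (hc.stronglyMeasurableAtFilter _ _) hc.continuousAt)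
    have h2 := h1.tendsto_slope_zero_right
    simpa using h2
  have h1 := ((key ε).sub (key 0)).const_smul ε⁻¹
  simp only [Real.toNNReal_zero, S.zero_apply, zero_add] at h1
  refine h1.congr' ?_
  filter_upwards [self_mem_nhdsWithin] with t ht
  rw [S.apply_avg_sub hε.le (le_of_lt ht), smul_comm t⁻¹, smul_sub t⁻¹]

theorem IsGenerator.dense_domain (h : IsGenerator A S) : Dense (A.domain : Set H) := by
  intro x
  refine mem_closure_of_tendsto (S.tendsto_avg x) ?_
  filter_upwards [self_mem_nhdsWithin] with ε hε
  exact LinearPMap.mem_domain_of_mem_graph (h.avg_mem hε x)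

/-- The right derivative of `s ↦ S₁(t - s) S₀(s) x`, for `x` in the domains of both generators
along the orbit. -/
theorem hasDerivWithinAt_comp_semigroup {A₀ A₁ : H →ₗ.[𝕜] H} {S₀ S₁ : C0Semigroup 𝕜 H}
    (h₀ : IsGenerator A₀ S₀) (h₁ : IsGenerator A₁ S₁) {x a b : H} {s t : ℝ} (hs : 0 ≤ s)
    (hst : s < t) (ha : (S₀.toFun s.toNNReal x, a) ∈ A₀.graph)
    (hb : (S₀.toFun s.toNNReal x, b) ∈ A₁.graph) :
    HasDerivWithinAt (fun r : ℝ => S₁.toFun (t - r).toNNReal (S₀.toFun r.toNNReal x))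
      (S₁.toFun (t - s).toNNReal (a - b)) (Set.Ioi s) s := by
  rw [hasDerivWithinAt_iff_tendsto_slope' (by simp)]
  set v := S₀.toFun s.toNNReal x with hv
  have hsub : Tendsto (fun r : ℝ => r - s) (𝓝[>] s) (𝓝[>] 0) := by
    refine tendsto_nhdsWithin_iff.2 ⟨?_, ?_⟩
    · have : Continuous fun r : ℝ => r - s := by fun_prop
      simpa using (this.tendsto s).mono_left nhdsWithin_le_nhds
    · filter_upwards [self_mem_nhdsWithin] with r hr using sub_pos.2 (show s < r from hr)
  have hlim := (((isGenerator_iff.1 h₀ _ _).1 ha).sub ((isGenerator_iff.1 h₁ _ _).1 hb)).comp hsub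
  have ht : Tendsto (fun r : ℝ => (t - r).toNNReal) (𝓝[>] s) (𝓝 (t - s).toNNReal) := by
    have : Continuous fun r : ℝ => (t - r).toNNReal := by fun_prop
    exact (this.tendsto s).mono_left nhdsWithin_le_nhds
  have := (S₁.continuous_uncurry.tendsto _).comp (ht.prodMk_nhds hlim)
  refine this.congr' ?_
  have hlt : ∀ᶠ r in 𝓝[>] s, r < t := nhdsWithin_le_nhds (eventually_lt_nhds hst)
  filter_upwards [self_mem_nhdsWithin, hlt] with r hr hrt
  have hr : s < r := hr
  have e1 : S₀.toFun r.toNNReal x = S₀.toFun (r - s).toNNReal v := by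
    rw [hv, ← S₀.add_toNNReal_apply (by linarith) hs, sub_add_cancel]
  have e2 : S₁.toFun (t - s).toNNReal v =
      S₁.toFun (t - r).toNNReal (S₁.toFun (r - s).toNNReal v) := by
    rw [← S₁.add_toNNReal_apply (by linarith) (by linarith), sub_add_sub_cancel]
  simp only [Function.comp_apply, slope_def_module]
  rw [e1, ← hv, e2, ← smul_sub, RCLike.real_smul_eq_coe_smul (K := 𝕜), map_smul, ← map_sub,
    ← RCLike.real_smul_eq_coe_smul (K := 𝕜)]
  congr 2
  abel

theorem IsGenerator.apply_sub_eq_integral (h : IsGenerator A S) {x y : H} (hxy : (x, y) ∈ A.graph)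
    {t : ℝ} (ht : 0 ≤ t) :
    S.toFun t.toNNReal x - x = ∫ s in (0 : ℝ)..t, S.toFun s.toNNReal y := by
  have hc : ∀ x, Continuous fun s : ℝ => S.toFun s.toNNReal x := fun x =>
    S.continuous_comp continuous_id continuous_const
  have := intervalIntegral.integral_eq_sub_of_hasDeriv_right (a := 0) (b := t)
    (f := fun s : ℝ => S.toFun s.toNNReal x) (f' := fun s : ℝ => S.toFun s.toNNReal y)
    (hc x).continuousOn ?_ ((hc y).intervalIntegrable _ _)
  · simpa [S.zero_apply] using this.symm
  · intro s hs
    rw [min_eq_left ht, max_eq_right ht] at hs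
    rw [hasDerivWithinAt_iff_tendsto_slope' (by simp)]
    have hsub : Tendsto (fun r : ℝ => r - s) (𝓝[>] s) (𝓝[>] 0) := by
      refine tendsto_nhdsWithin_iff.2 ⟨?_, ?_⟩
      · have : Continuous fun r : ℝ => r - s := by fun_prop
        simpa using (this.tendsto s).mono_left nhdsWithin_le_nhds
      · filter_upwards [self_mem_nhdsWithin] with r hr using sub_pos.2 (show s < r from hr)
    have h1 := (isGenerator_iff.1 h _ _).1 (h.map_mem s.toNNReal hxy)
    refine (h1.comp hsub).congr' ?_
    filter_upwards [self_mem_nhdsWithin] with r hr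
    have hr : s < r := hr
    simp only [Function.comp_apply, slope_def_module]
    rw [← S.add_toNNReal_apply (by linarith) hs.1.le, sub_add_cancel]

/-- Variation of constants: the semigroup generated by `A + K` in terms of the one generated
by `A`. -/
theorem perturb_apply_eq_add_integral {K : H →L[𝕜] H} {S₁ : C0Semigroup 𝕜 H}
    (h : IsGenerator A S) (h₁ : IsGenerator (perturb A K) S₁) {t : ℝ} (ht : 0 ≤ t) (x : H) :
    S₁.toFun t.toNNReal x = S.toFun t.toNNReal x +
      ∫ s in (0 : ℝ)..t, S₁.toFun (t - s).toNNReal (K (S.toFun s.toNNReal x)) := by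
  have hG : ∀ x, Continuous fun s : ℝ => (((S₁.toFun (t - s).toNNReal).comp K).comp
      (S.toFun s.toNNReal)) x := fun x =>
    S₁.continuous_comp (by fun_prop) (K.continuous.comp
      (S.continuous_comp continuous_id continuous_const))
  -- Writing the integral as a bounded operator makes both sides continuous in `x`, so the dense
  -- domain of `A` suffices.
  have hcl : IsClosed {x : H | S₁.toFun t.toNNReal x = S.toFun t.toNNReal x +
      strongIntegral _ hG 0 t x} := isClosed_eq (by fun_prop) (by fun_prop)
  refine (hcl.closure_subset_iff.2 ?_) (h.dense_domain x)
  intro x hx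
  obtain ⟨y, hxy⟩ := LinearPMap.mem_domain_iff.1 hx
  -- The path `r ↦ S₁(t - r) S(r) x` runs from `S₁(t) x` to `S(t) x`. Only its right derivative is
  -- supplied by the generators, and that is enough for the fundamental theorem.
  have hd := intervalIntegral.integral_eq_sub_of_hasDeriv_right (a := 0) (b := t)
    (f := fun r : ℝ => S₁.toFun (t - r).toNNReal (S.toFun r.toNNReal x))
    (f' := fun s => - S₁.toFun (t - s).toNNReal (K (S.toFun s.toNNReal x)))
    (S₁.continuous_comp (by fun_prop) (S.continuous_comp continuous_id continuous_const)).continuousOn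
    ?_ ((hG x).neg.intervalIntegrable _ _)
  · simp only [intervalIntegral.integral_neg, sub_self, Real.toNNReal_zero, S₁.zero_apply, sub_zero,
      S.zero_apply] at hd
    simp only [Set.mem_ofPred_eq, strongIntegral_apply, ContinuousLinearMap.comp_apply]
    rw [neg_eq_iff_eq_neg.1 hd]
    abel
  · intro s hs
    rw [min_eq_left ht, max_eq_right ht] at hs
    have hA := h.map_mem s.toNNReal hxy
    have hB : (S.toFun s.toNNReal x, S.toFun s.toNNReal y + K (S.toFun s.toNNReal x)) ∈
        (perturb A K).graph := mem_graph_perturb.2 (by simpa using hA)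
    have := hasDerivWithinAt_comp_semigroup h h₁ hs.1.le hs.2 hA hB
    simpa using this

end Control

/-! ### Duhamel's equation for a bounded perturbation. -/

namespace C0Semigroup

open scoped BoundedContinuousFunction

variable {𝕜 H : Type*} [RCLike 𝕜] [NormedAddCommGroup H] [InnerProductSpace 𝕜 H] [CompleteSpace H]
  (S : C0Semigroup 𝕜 H)

/-- The semigroup `t ↦ exp (c t) S(t)`. -/
noncomputable def rescale (c : ℝ) : C0Semigroup 𝕜 H where
  toFun t := ((Real.exp (c * t) : ℝ) : 𝕜) • S.toFun t
  map_zero := by simp [S.map_zero]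
  map_add s t := by
    rw [S.map_add]
    ext x
    simp only [NNReal.coe_add, mul_add, Real.exp_add, RCLike.ofReal_mul, smul_apply,
      ContinuousLinearMap.comp_apply, map_smul, smul_smul]
    rw [mul_comm]
  tendsto_zero x := by
    have h1 : Continuous fun t : ℝ≥0 => ((Real.exp (c * t) : ℝ) : 𝕜) :=
      RCLike.continuous_ofReal.comp (by fun_prop)
    simpa using (h1.tendsto 0).smul (S.tendsto_zero x)

variable [NormedSpace ℝ H] [IsScalarTower ℝ 𝕜 H]

theorem rescale_apply (c : ℝ) (t : ℝ≥0) (x : H) :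
    (S.rescale c).toFun t x = Real.exp (c * t) • S.toFun t x := by
  rw [RCLike.real_smul_eq_coe_smul (K := 𝕜)]; rfl

/-- The convolution `t ↦ ∫₀ᵗ S(t - s) K f(s) ds`. -/
noncomputable def conv (K : H →L[𝕜] H) (f : ℝ≥0 → H) (t : ℝ) : H :=
  ∫ s in (0 : ℝ)..t, S.toFun (t - s).toNNReal (K (f s.toNNReal))

theorem continuous_conv_integrand (K : H →L[𝕜] H) {f : ℝ≥0 → H} (hf : Continuous f) (t : ℝ) :
    Continuous fun s : ℝ => S.toFun (t - s).toNNReal (K (f s.toNNReal)) :=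
  S.continuous_comp (by fun_prop) (by fun_prop)

theorem continuous_conv (K : H →L[𝕜] H) {f : ℝ≥0 → H} (hf : Continuous f) :
    Continuous (S.conv K f) := by
  refine intervalIntegral.continuous_parametric_intervalIntegral_of_continuous
    (f := fun t s : ℝ => S.toFun (t - s).toNNReal (K (f s.toNNReal))) ?_ continuous_id
  exact S.continuous_comp (by fun_prop) (by fun_prop)

/-- Exponential decay gives `∫₀ᵗ exp (-μ (t - s)) ds ≤ 1 / μ` uniformly in `t`; the convolution is
therefore bounded on bounded functions, and a contraction once `M ‖K‖ < μ`. -/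
theorem norm_conv_le {M μ C : ℝ} (hM : 0 ≤ M) (hμ : 0 < μ)
    (hS : ∀ t : ℝ≥0, ‖S.toFun t‖ ≤ M * Real.exp (-μ * t)) (K : H →L[𝕜] H) {f : ℝ≥0 → H}
    (hC : ∀ t, ‖f t‖ ≤ C) {t : ℝ} (ht : 0 ≤ t) : ‖S.conv K f t‖ ≤ M * ‖K‖ / μ * C := by
  have hC0 : 0 ≤ C := (norm_nonneg _).trans (hC 0)
  have h1 : ∀ s ∈ Set.Ioc 0 t, ‖S.toFun (t - s).toNNReal (K (f s.toNNReal))‖ ≤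
      M * ‖K‖ * C * Real.exp (-μ * (t - s)) := by
    intro s hs
    have h2 := hS (t - s).toNNReal
    rw [Real.coe_toNNReal _ (sub_nonneg.2 hs.2)] at h2
    calc _ ≤ ‖S.toFun (t - s).toNNReal‖ * (‖K‖ * ‖f s.toNNReal‖) :=
          ((S.toFun _).le_opNorm _).trans (by gcongr; exact K.le_opNorm _)
      _ ≤ (M * Real.exp (-μ * (t - s))) * (‖K‖ * C) := by gcongr; exact hC _
      _ = _ := by ring
  have h2 : Continuous fun s : ℝ => M * ‖K‖ * C * Real.exp (-μ * (t - s)) := by fun_prop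
  have h3 : ∫ s in (0 : ℝ)..t, Real.exp (-μ * (t - s)) ≤ 1 / μ := by
    have : ∀ s ∈ Set.uIcc 0 t,
        HasDerivAt (fun s => Real.exp (-μ * (t - s)) / μ) (Real.exp (-μ * (t - s))) s := by
      intro s _
      have := ((((hasDerivAt_id s).const_sub t).const_mul (-μ)).exp).div_const μ
      simp only [id, mul_neg_one, neg_neg, mul_div_assoc, div_self hμ.ne', mul_one] at this
      exact this
    rw [intervalIntegral.integral_eq_sub_of_hasDerivAt this
      (Continuous.intervalIntegrable (by fun_prop) _ _)]
    simp only [sub_self, mul_zero, Real.exp_zero, sub_zero]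
    have : 0 ≤ Real.exp (-μ * t) / μ := by positivity
    linarith
  calc ‖S.conv K f t‖ ≤ ∫ s in (0 : ℝ)..t, M * ‖K‖ * C * Real.exp (-μ * (t - s)) :=
        intervalIntegral.norm_integral_le_of_norm_le ht (ae_of_all _ h1) (h2.intervalIntegrable _ _)
    _ = M * ‖K‖ * C * ∫ s in (0 : ℝ)..t, Real.exp (-μ * (t - s)) :=
        intervalIntegral.integral_const_mul _ _
    _ ≤ M * ‖K‖ * C * (1 / μ) := by gcongr
    _ = _ := by ring

/-- Convolution with an exponentially stable semigroup, as a bounded function. -/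
noncomputable def convBCF {M μ : ℝ} (hM : 0 ≤ M) (hμ : 0 < μ)
    (hS : ∀ t : ℝ≥0, ‖S.toFun t‖ ≤ M * Real.exp (-μ * t)) (K : H →L[𝕜] H) (f : ℝ≥0 →ᵇ H) :
    ℝ≥0 →ᵇ H :=
  BoundedContinuousFunction.ofNormedAddCommGroup (fun t : ℝ≥0 => S.conv K f t)
    ((S.continuous_conv K f.continuous).comp NNReal.continuous_coe) (M * ‖K‖ / μ * ‖f‖)
    fun t => S.norm_conv_le hM hμ hS K f.norm_coe_le_norm t.coe_nonneg

/-- Convolution with an exponentially stable semigroup as an operator on bounded functions. -/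
noncomputable def convCLM {M μ : ℝ} (hM : 0 ≤ M) (hμ : 0 < μ)
    (hS : ∀ t : ℝ≥0, ‖S.toFun t‖ ≤ M * Real.exp (-μ * t)) (K : H →L[𝕜] H) :
    (ℝ≥0 →ᵇ H) →L[𝕜] (ℝ≥0 →ᵇ H) :=
  LinearMap.mkContinuous
    { toFun := S.convBCF hM hμ hS K
      map_add' := fun f g => by
        ext t
        have := intervalIntegral.integral_add (μ := volume) (a := 0) (b := t)
          ((S.continuous_conv_integrand K f.continuous t).intervalIntegrable _ _)
          ((S.continuous_conv_integrand K g.continuous t).intervalIntegrable _ _)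
        simp only [← _root_.map_add] at this
        exact this
      map_smul' := fun c f => by
        ext t
        have := intervalIntegral.integral_smul (μ := volume) (a := 0) (b := t) c
          fun s : ℝ => S.toFun (t - s).toNNReal (K (f s.toNNReal))
        refine Eq.trans ?_ this
        exact intervalIntegral.integral_congr fun s _ => by simp } (M * ‖K‖ / μ)
    fun f => BoundedContinuousFunction.norm_ofNormedAddCommGroup_le _ (by positivity)
      fun t => S.norm_conv_le hM hμ hS K f.norm_coe_le_norm t.coe_nonneg

theorem norm_convCLM_le {M μ : ℝ} (hM : 0 ≤ M) (hμ : 0 < μ)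
    (hS : ∀ t : ℝ≥0, ‖S.toFun t‖ ≤ M * Real.exp (-μ * t)) (K : H →L[𝕜] H) :
    ‖S.convCLM hM hμ hS K‖ ≤ M * ‖K‖ / μ :=
  LinearMap.mkContinuous_norm_le _ (by positivity) _

/-- The orbits of a bounded semigroup as bounded functions. -/
noncomputable def orbitCLM {M : ℝ} (hM : 0 ≤ M) (hS : ∀ t : ℝ≥0, ‖S.toFun t‖ ≤ M) :
    H →L[𝕜] (ℝ≥0 →ᵇ H) :=
  LinearMap.mkContinuous
    { toFun := fun x => BoundedContinuousFunction.ofNormedAddCommGroup (fun t => S.toFun t x)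
        (S.continuous_apply x) (M * ‖x‖) fun t => (S.toFun t).le_of_opNorm_le (hS t) x
      map_add' := fun x y => by ext t; simp
      map_smul' := fun c x => by ext t; simp } M
    fun x => BoundedContinuousFunction.norm_ofNormedAddCommGroup_le _ (by positivity)
      fun t => (S.toFun t).le_of_opNorm_le (hS t) x

/-- Split the integral at `r`: the first piece factors through `S(t)`, the second is translated.
With uniqueness for Duhamel's equation this yields the semigroup law of the perturbation. -/
theorem conv_add (K : H →L[𝕜] H) {f : ℝ≥0 → H} (hf : Continuous f) (t r : ℝ≥0) :
    S.conv K f (t + r : ℝ≥0) = S.toFun t (S.conv K f r) + S.conv K (fun s => f (s + r)) t := by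
  have i : ∀ t a b : ℝ, IntervalIntegrable (fun s : ℝ => S.toFun (t - s).toNNReal (K (f s.toNNReal)))
      volume a b := fun t a b => (S.continuous_conv_integrand K hf t).intervalIntegrable _ _
  simp only [conv]
  rw [← intervalIntegral.integral_add_adjacent_intervals (i _ 0 r) (i _ r (t + r : ℝ≥0)),
    ← ContinuousLinearMap.intervalIntegral_comp_comm _ (i _ 0 r)]
  congr 1
  · refine intervalIntegral.integral_congr fun s hs => ?_
    rw [Set.uIcc_of_le r.coe_nonneg] at hs
    have : (((t + r : ℝ≥0) : ℝ) - s).toNNReal = t + ((r : ℝ) - s).toNNReal := by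
      rw [NNReal.coe_add, add_sub_assoc, Real.toNNReal_add t.coe_nonneg (sub_nonneg.2 hs.2),
        Real.toNNReal_coe]
    simp only [this, S.add_apply]
  · have := intervalIntegral.integral_comp_add_right (a := 0) (b := t)
      (fun s : ℝ => S.toFun (((t + r : ℝ≥0) : ℝ) - s).toNNReal (K (f s.toNNReal))) r
    rw [zero_add] at this
    rw [← NNReal.coe_add] at this
    rw [← this]
    refine intervalIntegral.integral_congr fun s hs => ?_
    rw [Set.uIcc_of_le t.coe_nonneg] at hs
    simp only [NNReal.coe_add, add_sub_add_right_eq_sub]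
    rw [Real.toNNReal_add hs.1 r.coe_nonneg, Real.toNNReal_coe]

/-- Duhamel's equation reads `(1 - V) f = J x` with `‖V‖ < 1`, so it has exactly one bounded
solution, depending linearly and continuously on `x`. The semigroup law is uniqueness: the orbit of
`x` translated by `t` solves the equation with initial value `W(t) x`. -/
theorem exists_perturbation_of_small {M μ : ℝ} (hM : 0 ≤ M) (hμ : 0 < μ)
    (hS : ∀ t : ℝ≥0, ‖S.toFun t‖ ≤ M * Real.exp (-μ * t)) (K : H →L[𝕜] H) (hK : M * ‖K‖ < μ) :
    ∃ W : C0Semigroup 𝕜 H, ∀ t x, W.toFun t x = S.toFun t x + S.conv K (fun s => W.toFun s x) t := by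
  set V := S.convCLM hM hμ hS K
  have hS' : ∀ t : ℝ≥0, ‖S.toFun t‖ ≤ M := fun t => by
    refine (hS t).trans (mul_le_of_le_one_right hM (Real.exp_le_one_iff.2 ?_))
    rw [neg_mul]
    exact neg_nonpos.2 (by positivity)
  set J := S.orbitCLM hM hS'
  have hV : ‖V‖ < 1 :=
    (S.norm_convCLM_le hM hμ hS K).trans_lt ((div_lt_one hμ).2 hK)
  set R : (ℝ≥0 →ᵇ H) →L[𝕜] (ℝ≥0 →ᵇ H) := ↑(Units.oneSub V hV)⁻¹
  have hR1 : ∀ f, (1 - V) (R f) = f := fun f => by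
    have := (Units.oneSub V hV).mul_inv
    exact congrArg (fun T : (ℝ≥0 →ᵇ H) →L[𝕜] (ℝ≥0 →ᵇ H) => T f) this
  have hR2 : ∀ f, R ((1 - V) f) = f := fun f => by
    have := (Units.oneSub V hV).inv_mul
    exact congrArg (fun T : (ℝ≥0 →ᵇ H) →L[𝕜] (ℝ≥0 →ᵇ H) => T f) this
  have hW : ∀ x t, R (J x) t = S.toFun t x + S.conv K (R (J x)) t := by
    intro x t
    have := congrArg (fun f : ℝ≥0 →ᵇ H => f t) (hR1 (J x))
    simp only [sub_apply, one_apply_eq_self, BoundedContinuousFunction.sub_apply] at this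
    rw [sub_eq_iff_eq_add] at this
    exact this
  have huniq : ∀ x (f : ℝ≥0 →ᵇ H), (∀ t, f t = S.toFun t x + S.conv K f t) → R (J x) = f := by
    intro x f hf
    have : (1 - V) f = J x := by
      ext t
      simp only [sub_apply, one_apply_eq_self, BoundedContinuousFunction.sub_apply]
      rw [sub_eq_iff_eq_add]
      exact hf t
    rw [← this, hR2]
  refine ⟨
    { toFun := fun t => (BoundedContinuousFunction.evalCLM 𝕜 t).comp (R.comp J)
      map_zero := ?_
      map_add := ?_
      tendsto_zero := ?_ }, ?_⟩
  · ext x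
    have := hW x 0
    simpa [conv, S.zero_apply] using this
  · intro s t
    ext x
    simp only [ContinuousLinearMap.comp_apply, BoundedContinuousFunction.evalCLM_apply]
    have h1 := huniq (R (J x) t) ((R (J x)).compContinuous ⟨fun s => s + t, by fun_prop⟩) ?_
    · rw [h1]; rfl
    · intro r
      simp only [BoundedContinuousFunction.compContinuous_apply, ContinuousMap.coe_mk]
      rw [hW x (r + t), S.conv_add K (R (J x)).continuous, S.add_apply, hW x t, _root_.map_add (S.toFun r),
        add_assoc]
      rfl
  · intro x
    have := (R (J x)).continuous.tendsto 0
    rw [hW x 0] at this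
    simpa [conv, S.zero_apply] using this
  · intro t x
    exact hW x t

/-- Existence of the semigroup perturbed by a bounded operator, with Duhamel's formula. -/
theorem exists_perturbation (K : H →L[𝕜] H) :
    ∃ W : C0Semigroup 𝕜 H, ∀ t x, W.toFun t x = S.toFun t x + S.conv K (fun s => W.toFun s x) t := by
  obtain ⟨M, ω, hM, hω, hS⟩ := S.exists_growth_bound
  -- Multiplying `S(t)` by `exp (-c t)` turns the growth bound into decay at rate `μ > M ‖K‖`;
  -- multiplying `W` by `exp (c t)` undoes this at the end.
  set μ := M * ‖K‖ + 1
  set c := ω + μ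
  have hμ : 0 < μ := by positivity
  obtain ⟨W, hW⟩ := (S.rescale (-c)).exists_perturbation_of_small (M := M) (μ := μ) (by linarith) hμ
    (fun t => by
      have : ‖(S.rescale (-c)).toFun t‖ = Real.exp (-c * t) * ‖S.toFun t‖ := by
        simp only [rescale, norm_smul, RCLike.norm_ofReal, abs_of_pos (Real.exp_pos _)]
      rw [this]
      calc _ ≤ Real.exp (-c * t) * (M * Real.exp (ω * t)) := by gcongr; exact hS t
        _ = M * (Real.exp (-c * t) * Real.exp (ω * t)) := by ring
        _ = _ := by rw [← Real.exp_add]; congr 2; ring) K (lt_add_one _)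
  refine ⟨W.rescale c, fun t x => ?_⟩
  have e : ∀ r : ℝ, Real.exp (c * r) * Real.exp (-c * r) = 1 := fun r => by
    rw [← Real.exp_add]; simp
  rw [rescale_apply, hW, rescale_apply, smul_add, smul_smul, e, one_smul]
  congr 1
  rw [conv, conv, ← intervalIntegral.integral_smul]
  refine intervalIntegral.integral_congr fun s hs => ?_
  rw [Set.uIcc_of_le t.coe_nonneg] at hs
  simp only [rescale_apply]
  rw [Real.coe_toNNReal _ (sub_nonneg.2 hs.2), Real.coe_toNNReal _ hs.1, smul_smul,
    RCLike.real_smul_eq_coe_smul (K := 𝕜) (Real.exp (c * s)), map_smul, map_smul,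
    ← RCLike.real_smul_eq_coe_smul (K := 𝕜), ← Real.exp_add]
  congr 2
  ring

end C0Semigroup

/-! ### The generator of the perturbed semigroup. -/

namespace Control

variable {𝕜 H : Type*} [RCLike 𝕜] [NormedAddCommGroup H] [InnerProductSpace 𝕜 H] [CompleteSpace H]
  [NormedSpace ℝ H] [IsScalarTower ℝ 𝕜 H] {A : H →ₗ.[𝕜] H} {S : C0Semigroup 𝕜 H}

theorem IsGenerator.exists_perturb (h : IsGenerator A S) (K : H →L[𝕜] H) :
    ∃ W : C0Semigroup 𝕜 H, IsGenerator (perturb A K) W := by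
  obtain ⟨W, hW⟩ := S.exists_perturbation K
  refine ⟨W, isGenerator_iff.2 fun x y => ?_⟩
  rw [mem_graph_perturb, isGenerator_iff.1 h]
  -- The difference quotients of `W` and `S` differ by this mean value of a jointly continuous
  -- function equal to `K x` at `(0, 0)`. Hence one converges exactly when the other does, which
  -- identifies the domains too.
  have hlim : Tendsto (fun t : ℝ => t⁻¹ • S.conv K (fun s => W.toFun s x) t) (𝓝[>] 0) (𝓝 (K x)) := by
    have hG : Continuous fun p : ℝ × ℝ =>
        S.toFun (p.1 - p.2).toNNReal (K (W.toFun p.2.toNNReal x)) :=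
      S.continuous_comp (by fun_prop)
        (K.continuous.comp (W.continuous_comp continuous_snd continuous_const))
    have h0 := Metric.tendsto_nhds.1 (hG.tendsto (0, 0))
    simp only [sub_zero, Real.toNNReal_zero, S.zero_apply, W.zero_apply] at h0
    rw [Metric.tendsto_nhds]
    intro ε hε
    obtain ⟨δ, hδ, hball⟩ := Metric.eventually_nhds_iff.1 (h0 (ε / 2) (by positivity))
    filter_upwards [self_mem_nhdsWithin, nhdsWithin_le_nhds (eventually_lt_nhds hδ)] with t ht htδ
    have ht : 0 < t := ht
    have h1 : S.conv K (fun s => W.toFun s x) t - t • K x = ∫ s in (0 : ℝ)..t,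
        (S.toFun (t - s).toNNReal (K (W.toFun s.toNNReal x)) - K x) := by
      rw [intervalIntegral.integral_sub
        ((S.continuous_conv_integrand K (W.continuous_apply x) t).intervalIntegrable _ _)
        intervalIntegrable_const, intervalIntegral.integral_const, sub_zero]
      rfl
    have h2 := intervalIntegral.norm_integral_le_of_norm_le_const (a := 0) (b := t)
      (f := fun s => S.toFun (t - s).toNNReal (K (W.toFun s.toNNReal x)) - K x) (C := ε / 2)
      fun s hs => by
        rw [Set.uIoc_of_le ht.le] at hs
        rw [← dist_eq_norm]
        refine (hball (y := (t, s)) ?_).le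
        rw [Prod.dist_eq, Real.dist_eq, Real.dist_eq, sub_zero, sub_zero, abs_of_pos ht,
          abs_of_pos hs.1]
        exact max_lt htδ (hs.2.trans_lt htδ)
    rw [← h1, sub_zero, abs_of_pos ht] at h2
    have h3 : t⁻¹ • S.conv K (fun s => W.toFun s x) t - K x =
        t⁻¹ • (S.conv K (fun s => W.toFun s x) t - t • K x) := by
      rw [smul_sub, smul_smul, inv_mul_cancel₀ ht.ne', one_smul]
    rw [dist_eq_norm, h3, norm_smul, norm_inv, Real.norm_eq_abs, abs_of_pos ht]
    calc _ ≤ t⁻¹ * (ε / 2 * t) := by gcongr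
      _ = ε / 2 := by field_simp
      _ < ε := by linarith
  have hq : ∀ᶠ t : ℝ in 𝓝[>] 0, t⁻¹ • (W.toFun t.toNNReal x - x) =
      t⁻¹ • (S.toFun t.toNNReal x - x) + t⁻¹ • S.conv K (fun s => W.toFun s x) t := by
    filter_upwards [self_mem_nhdsWithin] with t ht
    rw [hW, Real.coe_toNNReal t (le_of_lt ht), ← smul_add]
    congr 1
    abel
  constructor
  · intro h1
    have := h1.add hlim
    rw [sub_add_cancel] at this
    exact this.congr' (hq.mono fun t ht => ht.symm)
  · intro h1
    refine (h1.sub hlim).congr' (hq.mono fun t ht => ?_)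
    rw [ht, add_sub_cancel_right]

end Control

/-! ### Regularization in `D(A*)` and the observation map. -/

namespace Control

variable {𝕜 H U : Type*} [RCLike 𝕜] [NormedAddCommGroup H] [InnerProductSpace 𝕜 H] [CompleteSpace H]
  [NormedAddCommGroup U] [InnerProductSpace 𝕜 U] [CompleteSpace U]
  [NormedSpace ℝ H] [IsScalarTower ℝ 𝕜 H]
  {A : H →ₗ.[𝕜] H} {S : C0Semigroup 𝕜 H}

/-- Dual to `avg ε (A a) = ε⁻¹ (S(ε) a - a)`: the adjoint averages send all of `H` into `D(A*)`,
with `A*` bounded after them. -/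
theorem IsGenerator.avg_adjoint_mem (h : IsGenerator A S) {ε : ℝ} (hε : 0 < ε) (z : H) :
    ((S.avg ε).adjoint z, ((ε⁻¹ : ℝ) : 𝕜) • ((S.toFun ε.toNNReal).adjoint z - z)) ∈ AdjDom A := by
  rw [Submodule.mem_adjoint_iff]
  intro a b hab
  have h1 : S.avg ε b = ((ε⁻¹ : ℝ) : 𝕜) • (S.toFun ε.toNNReal a - a) := by
    rw [h.apply_sub_eq_integral hab hε.le, S.avg_apply, RCLike.real_smul_eq_coe_smul (K := 𝕜)]
  simp only [ContinuousLinearMap.adjoint_inner_right, h1, inner_smul_left, inner_smul_right,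
    RCLike.conj_ofReal, inner_sub_left, inner_sub_right]
  ring

/-- On `D(A*)` the adjoint averages commute with `A*`. This makes the regularizations converge in
the graph norm, the only norm for which `B*` is continuous. -/
theorem IsGenerator.avg_adjoint_apply (h : IsGenerator A S) {ε : ℝ} (hε : 0 < ε) (z : AdjDom A) :
    ((ε⁻¹ : ℝ) : 𝕜) • ((S.toFun ε.toNNReal).adjoint z.1.1 - z.1.1) = (S.avg ε).adjoint z.1.2 := by
  refine ext_inner_left 𝕜 fun x => ?_
  have h1 := (Submodule.mem_adjoint_iff _ _).1 z.2 _ _ (h.avg_mem hε x)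
  rw [RCLike.real_smul_eq_coe_smul (K := 𝕜), sub_eq_zero] at h1
  rw [ContinuousLinearMap.adjoint_inner_right, ← h1]
  simp only [ContinuousLinearMap.adjoint_inner_right, inner_smul_left, inner_smul_right,
    RCLike.conj_ofReal, inner_sub_left, inner_sub_right]

/-- The adjoint mean value operator as a bounded operator from `H` to `D(A*)`. -/
noncomputable def avgLift (h : IsGenerator A S) {ε : ℝ} (hε : 0 < ε) : H →L[𝕜] AdjDom A :=
  ((S.avg ε).adjoint.prod (((ε⁻¹ : ℝ) : 𝕜) •
    ((S.toFun ε.toNNReal).adjoint - ContinuousLinearMap.id 𝕜 H))).codRestrict (AdjDom A)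
    fun z => h.avg_adjoint_mem hε z

@[simp]
theorem avgLift_fst (h : IsGenerator A S) {ε : ℝ} (hε : 0 < ε) (z : H) :
    (avgLift h hε z).1.1 = (S.avg ε).adjoint z := rfl

theorem avgLift_snd (h : IsGenerator A S) {ε : ℝ} (hε : 0 < ε) (z : H) :
    (avgLift h hε z).1.2 = ((ε⁻¹ : ℝ) : 𝕜) • ((S.toFun ε.toNNReal).adjoint z - z) := rfl

theorem avgLift_coe_snd (h : IsGenerator A S) {ε : ℝ} (hε : 0 < ε) (z : AdjDom A) :
    (avgLift h hε z.1.1).1.2 = (S.avg ε).adjoint z.1.2 := h.avg_adjoint_apply hε z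

theorem adjFlow_avgLift (h : IsGenerator A S) {ε : ℝ} (hε : 0 < ε) (t : ℝ≥0) (z : H) :
    adjFlow h t (avgLift h hε z) = avgLift h hε ((S.toFun t).adjoint z) := by
  refine Subtype.ext (Prod.ext ?_ ?_)
  · change (S.toFun t).adjoint ((S.avg ε).adjoint z) = (S.avg ε).adjoint ((S.toFun t).adjoint z)
    rw [S.adjoint_avg, ← S.adjoint_toFun, S.adjoint.avg_commute]
  · change (S.toFun t).adjoint (((ε⁻¹ : ℝ) : 𝕜) • ((S.toFun ε.toNNReal).adjoint z - z)) = _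
    rw [avgLift_snd, map_smul, map_sub, ← S.adjoint_toFun, ← S.adjoint_toFun,
      S.adjoint.commute_apply]

theorem tendsto_adjoint_avg (S : C0Semigroup 𝕜 H) (z : H) :
    Tendsto (fun n : ℕ => (S.avg (1 / ((n : ℝ) + 1))).adjoint z) atTop (𝓝 z) := by
  have h1 : Tendsto (fun n : ℕ => (1 / ((n : ℝ) + 1))) atTop (𝓝[>] 0) :=
    tendsto_nhdsWithin_iff.2 ⟨tendsto_one_div_add_atTop_nhds_zero_nat,
      Eventually.of_forall fun n => by simp only [Set.mem_Ioi]; positivity⟩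
  simp only [S.adjoint_avg]
  exact (S.adjoint.tendsto_avg z).comp h1

theorem tendsto_avgLift (h : IsGenerator A S) (z : AdjDom A) :
    Tendsto (fun n : ℕ => avgLift h (Nat.one_div_pos_of_nat (α := ℝ) (n := n)) z.1.1) atTop
      (𝓝 z) := by
  rw [tendsto_subtype_rng]
  refine ((tendsto_adjoint_avg S z.1.1).prodMk_nhds (tendsto_adjoint_avg S z.1.2)).congr
    fun n => ?_
  rw [← avgLift_coe_snd h (Nat.one_div_pos_of_nat (α := ℝ) (n := n)) z]
  rfl

theorem exists_norm_adjoint_avg_le (S : C0Semigroup 𝕜 H) :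
    ∃ M : ℝ, 0 < M ∧ ∀ (n : ℕ) (z : H),
      ‖(S.avg (1 / ((n : ℝ) + 1))).adjoint z‖ ≤ M * ‖z‖ := by
  obtain ⟨M, hM0, hM⟩ := S.adjoint.exists_bound_Icc 0 1
  refine ⟨M, hM0, fun n z => ?_⟩
  rw [S.adjoint_avg]
  exact S.adjoint.norm_avg_le hM Nat.one_div_pos_of_nat
    (by rw [div_le_one (by positivity)]; simp) z

theorem norm_avgLift_le (h : IsGenerator A S) {M : ℝ} (hM0 : 0 ≤ M)
    (hM : ∀ (n : ℕ) (z : H), ‖(S.avg (1 / ((n : ℝ) + 1))).adjoint z‖ ≤ M * ‖z‖) (n : ℕ)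
    (z : AdjDom A) :
    ‖avgLift h (Nat.one_div_pos_of_nat (α := ℝ) (n := n)) z.1.1‖ ≤ M * ‖z‖ := by
  change max ‖_‖ ‖(avgLift h (Nat.one_div_pos_of_nat (α := ℝ) (n := n)) z.1.1).1.2‖ ≤ _
  rw [avgLift_coe_snd]
  refine max_le ((hM n _).trans ?_) ((hM n _).trans ?_)
  · gcongr; exact norm_fst_le z.1
  · gcongr; exact norm_snd_le z.1

theorem continuous_adjFlow (h : IsGenerator A S) (z : AdjDom A) :
    Continuous fun t : ℝ => adjFlow h t.toNNReal z :=
  Continuous.subtype_mk ((S.adjoint.continuous_comp continuous_id continuous_const).prodMk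
    (S.adjoint.continuous_comp continuous_id continuous_const)) _

theorem continuous_observe (h : IsGenerator A S) (B : ControlOp A U) (z : AdjDom A) :
    Continuous (observe h B z) :=
  (ControlOp.dual B).continuous.comp (continuous_adjFlow h z)

theorem observe_avgLift (h : IsGenerator A S) (B : ControlOp A U) {ε : ℝ} (hε : 0 < ε) (z : H)
    (t : ℝ) : observe h B (avgLift h hε z) t =
      ControlOp.dual B (avgLift h hε ((S.toFun t.toNNReal).adjoint z)) := by
  rw [observe, adjFlow_avgLift]

theorem observe_add (h : IsGenerator A S) (B : ControlOp A U) (z w : AdjDom A) (t : ℝ) :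
    observe h B (z + w) t = observe h B z t + observe h B w t := by
  rw [observe, observe, observe, ← map_add]
  congr 1
  refine Subtype.ext (Prod.ext ?_ ?_)
  · exact map_add _ _ _
  · exact map_add _ _ _

theorem observe_smul (h : IsGenerator A S) (B : ControlOp A U) (c : 𝕜) (z : AdjDom A) (t : ℝ) :
    observe h B (c • z) t = c • observe h B z t := by
  rw [observe, observe, ← map_smul]
  congr 1
  refine Subtype.ext (Prod.ext ?_ ?_)
  · exact map_smul _ _ _
  · exact map_smul _ _ _

/-- The projection `D(A*) → H`. -/
noncomputable def adjDomFst (A : H →ₗ.[𝕜] H) : AdjDom A →ₗ[𝕜] H :=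
  (LinearMap.fst 𝕜 H H).comp (AdjDom A).subtype

@[simp]
theorem adjDomFst_apply (z : AdjDom A) : adjDomFst A z = z.1.1 := rfl

theorem IsGenerator.denseRange_adjDomFst (h : IsGenerator A S) : DenseRange (adjDomFst A) :=
  fun z => mem_closure_of_tendsto (tendsto_adjoint_avg S z) (Eventually.of_forall fun n =>
    ⟨avgLift h (Nat.one_div_pos_of_nat (α := ℝ) (n := n)) z, rfl⟩)

/-- `L²(0, T; U)`. -/
noncomputable abbrev TimeL2 (U : Type*) [NormedAddCommGroup U] (T : ℝ) :=
  Lp U 2 (volume.restrict (Set.Ioc 0 T))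

theorem memLp_of_continuous {f : ℝ → U} (hf : Continuous f) (T : ℝ) :
    MemLp f 2 (volume.restrict (Set.Ioc 0 T)) := by
  obtain ⟨C, hC⟩ := isCompact_Icc.exists_bound_of_continuousOn (hf.continuousOn (s := Set.Icc 0 T))
  refine MemLp.of_bound hf.aestronglyMeasurable.restrict C ?_
  filter_upwards [ae_restrict_mem measurableSet_Ioc] with t ht
  exact hC t ⟨ht.1.le, ht.2⟩

theorem norm_sq_eq_integral (𝕜 : Type*) [RCLike 𝕜] {U : Type*} [NormedAddCommGroup U]
    [InnerProductSpace 𝕜 U] {α : Type*} {m : MeasurableSpace α} {μ : Measure α} (f : Lp U 2 μ) :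
    ‖f‖ ^ 2 = ∫ a, ‖f a‖ ^ 2 ∂μ := by
  let _ : InnerProductSpace ℝ U := InnerProductSpace.rclikeToReal 𝕜 U
  rw [← real_inner_self_eq_norm_sq, L2.inner_def]
  simp only [real_inner_self_eq_norm_sq]

/-- The map `z ↦ B* S(·)* z` from `D(A*)` to `L²(0, T; U)`. -/
noncomputable def observeLin (h : IsGenerator A S) (B : ControlOp A U) (T : ℝ) :
    AdjDom A →ₗ[𝕜] TimeL2 U T where
  toFun z := (memLp_of_continuous (continuous_observe h B z) T).toLp _
  map_add' z w := by
    rw [← MemLp.toLp_add]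
    exact MemLp.toLp_congr _ _ (ae_of_all _ fun t => observe_add h B z w t)
  map_smul' c z := by
    rw [RingHom.id_apply, ← MemLp.toLp_const_smul]
    exact MemLp.toLp_congr _ _ (ae_of_all _ fun t => observe_smul h B c z t)

theorem observeLin_ae (h : IsGenerator A S) (B : ControlOp A U) (T : ℝ) (z : AdjDom A) :
    observeLin h B T z =ᵐ[volume.restrict (Set.Ioc 0 T)] observe h B z :=
  MemLp.coeFn_toLp (memLp_of_continuous (continuous_observe h B z) T)

theorem norm_sq_observeLin (h : IsGenerator A S) (B : ControlOp A U) {T : ℝ} (hT : 0 ≤ T)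
    (z : AdjDom A) : ‖observeLin h B T z‖ ^ 2 = ∫ t in (0 : ℝ)..T, ‖observe h B z t‖ ^ 2 := by
  rw [norm_sq_eq_integral 𝕜, intervalIntegral.integral_of_le hT]
  refine integral_congr_ae ?_
  filter_upwards [observeLin_ae h B T z] with t ht
  rw [ht]

/-- `B` is admissible if and only if the observation maps are bounded for the norm of `H`. -/
theorem isAdmissible_iff (h : IsGenerator A S) (B : ControlOp A U) :
    IsAdmissible h B ↔ ∀ T : ℝ, 0 < T → ∃ C : ℝ, ∀ z, ‖observeLin h B T z‖ ≤ C * ‖z.1.1‖ := by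
  refine forall₂_congr fun T hT => ⟨?_, ?_⟩
  · rintro ⟨C, hC, hz⟩
    refine ⟨√C, fun z => ?_⟩
    rw [← Real.sqrt_sq (norm_nonneg (z.1.1)), ← Real.sqrt_mul hC.le]
    refine Real.le_sqrt_of_sq_le ?_
    rw [norm_sq_observeLin h B hT.le]
    exact hz z
  · rintro ⟨C, hC⟩
    refine ⟨(max C 1) ^ 2, by positivity, fun z => ?_⟩
    rw [← norm_sq_observeLin h B hT.le, ← mul_pow]
    gcongr
    exact (hC z).trans (by gcongr; exact le_max_left _ _)

/-- The extension of `z ↦ B* S(·)* z` to `H`, for admissible `B`. -/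
noncomputable def obsCLM (h : IsGenerator A S) (B : ControlOp A U) (T : ℝ) : H →L[𝕜] TimeL2 U T :=
  (observeLin h B T).extendOfNorm (adjDomFst A)

/-- The extension is genuine because `D(A*)` is dense in `H` and admissibility bounds the
observation by the norm of `H`. -/
theorem obsCLM_apply {h : IsGenerator A S} {B : ControlOp A U} (hB : IsAdmissible h B) {T : ℝ}
    (hT : 0 < T) (z : AdjDom A) : obsCLM h B T z.1.1 = observeLin h B T z :=
  LinearMap.extendOfNorm_eq h.denseRange_adjDomFst ((isAdmissible_iff h B).1 hB T hT) z

end Control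

/-! ### Solutions and controllability through the adjoint of the observation map. -/

namespace Control

variable {𝕜 H U : Type*} [RCLike 𝕜] [NormedAddCommGroup H] [InnerProductSpace 𝕜 H] [CompleteSpace H]
  [NormedAddCommGroup U] [InnerProductSpace 𝕜 U] [CompleteSpace U]
  [NormedSpace ℝ H] [IsScalarTower ℝ 𝕜 H]
  {A : H →ₗ.[𝕜] H} {S : C0Semigroup 𝕜 H}

/-- The function `r ↦ w (t - r)` of `L²(0, T; U)`, for `w` in `L²(ℝ; U)`. -/
noncomputable def slice (𝕜 : Type*) [RCLike 𝕜] {U : Type*} [NormedAddCommGroup U]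
    [InnerProductSpace 𝕜 U] (T : ℝ) (w : Lp U 2 (volume : Measure ℝ)) (t : ℝ) : TimeL2 U T :=
  LpToLpRestrictCLM ℝ U 𝕜 volume 2 (Set.Ioc 0 T)
    (Lp.compMeasurePreserving (fun r => t - r) (Measure.measurePreserving_sub_left volume t) w)

theorem slice_ae (T : ℝ) (w : Lp U 2 (volume : Measure ℝ)) (t : ℝ) :
    slice 𝕜 T w t =ᵐ[volume.restrict (Set.Ioc 0 T)] fun r => w (t - r) :=
  (LpToLpRestrictCLM_coeFn 𝕜 _ _).trans (ae_restrict_of_ae (Lp.coeFn_compMeasurePreserving _ _))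

theorem continuous_slice (T : ℝ) (w : Lp U 2 (volume : Measure ℝ)) :
    Continuous (slice 𝕜 T w) := by
  refine (LpToLpRestrictCLM ℝ U 𝕜 volume 2 (Set.Ioc 0 T)).continuous.comp ?_
  let F : C(ℝ × ℝ, ℝ) := ⟨fun p => p.1 - p.2, by fun_prop⟩
  exact Continuous.compMeasurePreservingLp (f := fun _ => w) (g := fun t => F.curry t)
    continuous_const F.curry.continuous
    (fun t => Measure.measurePreserving_sub_left volume t) (by simp)

/-- A control on `(0, T)`, extended by zero. -/
noncomputable def extendControl {T : ℝ} {u : ℝ → U}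
    (hu : MemLp u 2 (volume.restrict (Set.Ioo 0 T))) : Lp U 2 (volume : Measure ℝ) :=
  MemLp.toLp ((Set.Ioo 0 T).indicator u) ((memLp_indicator_iff_restrict measurableSet_Ioo).2 hu)

theorem extendControl_ae {T : ℝ} {u : ℝ → U} (hu : MemLp u 2 (volume.restrict (Set.Ioo 0 T))) :
    extendControl hu =ᵐ[volume] (Set.Ioo 0 T).indicator u :=
  MemLp.coeFn_toLp _

theorem slice_extendControl_ae {T : ℝ} {u : ℝ → U}
    (hu : MemLp u 2 (volume.restrict (Set.Ioo 0 T))) (t : ℝ) :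
    slice 𝕜 T (extendControl hu) t =ᵐ[volume.restrict (Set.Ioc 0 T)]
      fun r => (Set.Ioo 0 T).indicator u (t - r) := by
  refine (slice_ae T _ t).trans (ae_restrict_of_ae ?_)
  have hmp : MeasurePreserving (fun r : ℝ => t - r) volume volume :=
    Measure.measurePreserving_sub_left volume t
  exact hmp.quasiMeasurePreserving.ae (extendControl_ae hu)

/-- Substitute `r = t - s`; the control extended by zero vanishes at `t - r` for `r ≥ t`, so the
pairing over `(0, T]` stops at `t`. A single map at the final time `T` thus describes the solution
at every time. -/
theorem inner_observeLin_slice (h : IsGenerator A S) (B : ControlOp A U) {T : ℝ} {u : ℝ → U}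
    (hu : MemLp u 2 (volume.restrict (Set.Ioo 0 T))) {t : ℝ} (ht : t ∈ Set.Icc 0 T)
    (z : AdjDom A) : ⟪observeLin h B T z, slice 𝕜 T (extendControl hu) t⟫_𝕜 =
      ∫ s in (0 : ℝ)..t, ⟪observe h B z (t - s), u s⟫_𝕜 := by
  have h1 := intervalIntegral.integral_comp_sub_left (a := 0) (b := t)
    (fun r => ⟪observe h B z r, u (t - r)⟫_𝕜) t
  simp only [sub_sub_cancel, sub_self, sub_zero] at h1
  rw [h1, intervalIntegral.integral_of_le ht.1, integral_Ioc_eq_integral_Ioo, L2.inner_def]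
  have h2 : Set.Ioo 0 t = Set.Ioc 0 T ∩ Set.Iio t := by
    ext r
    simp only [Set.mem_Ioo, Set.mem_inter_iff, Set.mem_Ioc, Set.mem_Iio]
    constructor
    · rintro ⟨a, b⟩
      exact ⟨⟨a, b.le.trans ht.2⟩, b⟩
    · rintro ⟨⟨a, -⟩, b⟩
      exact ⟨a, b⟩
  rw [h2, ← setIntegral_indicator measurableSet_Iio]
  refine integral_congr_ae ?_
  have hT : ∀ᵐ r ∂(volume.restrict (Set.Ioc 0 T)), r < T := by
    rw [← restrict_Ioo_eq_restrict_Ioc]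
    filter_upwards [ae_restrict_mem measurableSet_Ioo] with r hr using hr.2
  filter_upwards [observeLin_ae h B T z, slice_extendControl_ae (𝕜 := 𝕜) hu t,
    ae_restrict_mem measurableSet_Ioc] with r h3 h4 h5
  rw [h3, h4]
  by_cases hr : r < t
  · rw [Set.indicator_of_mem (show t - r ∈ Set.Ioo 0 T from
      ⟨sub_pos.2 hr, by have := h5.1; have := ht.2; linarith⟩),
      Set.indicator_of_mem (show r ∈ Set.Iio t from hr)]
  · rw [Set.indicator_of_notMem (fun hm : t - r ∈ Set.Ioo 0 T => hr (sub_pos.1 hm.1)),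
      Set.indicator_of_notMem (show r ∉ Set.Iio t from hr), inner_zero_right]

theorem isSolution_obsCLM {h : IsGenerator A S} {B : ControlOp A U} (hB : IsAdmissible h B) {T : ℝ}
    (hT : 0 < T) (y₀ : H) {u : ℝ → U} (hu : MemLp u 2 (volume.restrict (Set.Ioo 0 T))) :
    IsSolution h B T y₀ u fun t => S.toFun t.toNNReal y₀ +
      (obsCLM h B T).adjoint (slice 𝕜 T (extendControl hu) t) where
  continuousOn := ((S.continuous_comp continuous_id continuous_const).add
    ((obsCLM h B T).adjoint.continuous.comp (continuous_slice T _))).continuousOn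
  transposition t ht z := by
    rw [inner_add_right, ContinuousLinearMap.adjoint_inner_right,
      ContinuousLinearMap.adjoint_inner_left, obsCLM_apply hB hT, inner_observeLin_slice h B hu ht]

theorem IsSolution.eq {h : IsGenerator A S} {B : ControlOp A U} {T : ℝ} {y₀ : H} {u : ℝ → U}
    {y y' : ℝ → H} (hy : IsSolution h B T y₀ u y) (hy' : IsSolution h B T y₀ u y') {t : ℝ}
    (ht : t ∈ Set.Icc 0 T) : y t = y' t := by
  refine h.denseRange_adjDomFst.eq_of_inner_right 𝕜 ?_
  intro z
  rw [adjDomFst_apply, hy.transposition t ht z, hy'.transposition t ht z]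

theorem IsSolution.apply_eq {h : IsGenerator A S} {B : ControlOp A U} (hB : IsAdmissible h B)
    {T : ℝ} (hT : 0 < T) {y₀ : H} {u : ℝ → U} (hu : MemLp u 2 (volume.restrict (Set.Ioo 0 T)))
    {y : ℝ → H} (hy : IsSolution h B T y₀ u y) :
    y T = S.toFun T.toNNReal y₀ + (obsCLM h B T).adjoint (slice 𝕜 T (extendControl hu) T) :=
  hy.eq (isSolution_obsCLM hB hT y₀ hu) ⟨hT.le, le_rfl⟩

/-- At `t = T` the slice is time reversal, so every element of `L²(0, T; U)` arises from a control.
-/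
theorem exists_slice_eq {T : ℝ} (v : TimeL2 U T) :
    ∃ (u : ℝ → U) (hu : MemLp u 2 (volume.restrict (Set.Ioo 0 T))),
      slice 𝕜 T (extendControl hu) T = v := by
  have hpre : (fun r => T - r) ⁻¹' Set.Ioo 0 T = Set.Ioo 0 T := by
    ext r
    simp only [Set.mem_preimage, Set.mem_Ioo]
    constructor <;> rintro ⟨a, b⟩ <;> constructor <;> linarith
  have hmp := (Measure.measurePreserving_sub_left volume T).restrict_preimage
    (measurableSet_Ioo (a := 0) (b := T))
  rw [hpre] at hmp
  have hv : MemLp v 2 (volume.restrict (Set.Ioo 0 T)) := by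
    rw [restrict_Ioo_eq_restrict_Ioc]
    exact Lp.memLp v
  refine ⟨fun s => v (T - s), hv.comp_measurePreserving hmp, Lp.ext ?_⟩
  have hT : ∀ᵐ r ∂(volume.restrict (Set.Ioc 0 T)), r < T := by
    rw [← restrict_Ioo_eq_restrict_Ioc]
    filter_upwards [ae_restrict_mem measurableSet_Ioo] with r hr using hr.2
  filter_upwards [slice_extendControl_ae (𝕜 := 𝕜) (hv.comp_measurePreserving hmp) T, hT,
    ae_restrict_mem measurableSet_Ioc] with r h1 h2 h3
  refine h1.trans ?_
  rw [Set.indicator_of_mem (show T - r ∈ Set.Ioo 0 T from ⟨sub_pos.2 h2, by linarith [h3.1]⟩)]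
  simp

theorem exactlyControllable_iff {h : IsGenerator A S} {B : ControlOp A U} (hB : IsAdmissible h B)
    {T : ℝ} (hT : 0 < T) :
    ExactlyControllable h B T ↔ Function.Surjective (obsCLM h B T).adjoint := by
  constructor
  · intro hex y₁
    obtain ⟨u, hu, y, hy, hyT⟩ := hex 0 y₁
    refine ⟨slice 𝕜 T (extendControl hu) T, ?_⟩
    have := hy.apply_eq hB hT hu
    rw [map_zero, zero_add, hyT] at this
    exact this.symm
  · intro hsurj y₀ y₁
    obtain ⟨v, hv⟩ := hsurj (y₁ - S.toFun T.toNNReal y₀)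
    obtain ⟨u, hu, huv⟩ := exists_slice_eq (𝕜 := 𝕜) v
    exact ⟨u, hu, _, isSolution_obsCLM hB hT y₀ hu, by rw [huv, hv]; abel⟩

/-- A vector `z` killed by the observation map is orthogonal to every state reachable from `0`, yet
some such state lies within `‖z‖ / 2` of `z`. -/
theorem ApproximatelyControllable.eq_zero_of_obsCLM_eq_zero {h : IsGenerator A S}
    {B : ControlOp A U} {T : ℝ} (happ : ApproximatelyControllable h B T) (hB : IsAdmissible h B)
    (hT : 0 < T) {z : H} (hz : obsCLM h B T z = 0) : z = 0 := by
  by_contra hne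
  have hpos : 0 < ‖z‖ := norm_pos_iff.2 hne
  obtain ⟨u, hu, y, hy, hyT⟩ := happ (‖z‖ / 2) (by positivity) 0 z
  have h1 := hy.apply_eq hB hT hu
  rw [map_zero, zero_add] at h1
  have h2 : ⟪z, y T⟫_𝕜 = 0 := by
    rw [h1, ContinuousLinearMap.adjoint_inner_right, hz, inner_zero_left]
  have h3 : ‖z‖ ^ 2 ≤ ‖z‖ * (‖z‖ / 2) := by
    calc ‖z‖ ^ 2 = ‖⟪z, z - y T⟫_𝕜‖ := by
          rw [inner_sub_right, h2, sub_zero, inner_self_eq_norm_sq_to_K]; simp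
      _ ≤ ‖z‖ * ‖z - y T‖ := norm_inner_le_norm _ _
      _ ≤ _ := by gcongr; rwa [norm_sub_rev]
  nlinarith

end Control

/-! ### Compactness of the adjoint. -/

section CompactAdjoint

variable {𝕜 E F : Type*} [RCLike 𝕜] [NormedAddCommGroup E] [InnerProductSpace 𝕜 E] [CompleteSpace E]
  [NormedAddCommGroup F] [InnerProductSpace 𝕜 F] [CompleteSpace F]

/-- Schauder's theorem for Hilbert spaces. -/
theorem IsCompactOperator.adjoint {T : E →L[𝕜] F} (hT : IsCompactOperator T) :
    IsCompactOperator T.adjoint := by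
  have hc : IsCompactOperator (T.comp T.adjoint) := hT.comp_clm T.adjoint
  -- Since `‖T* x‖² = ⟪x, T T* x⟫`, total boundedness of the image of the ball under the compact
  -- operator `T T*` transfers to `T*`.
  have key : ∀ z w : F, z ∈ Metric.closedBall (0 : F) 1 → w ∈ Metric.closedBall (0 : F) 1 →
      ‖T.adjoint z - T.adjoint w‖ ^ 2 ≤ 2 * ‖T (T.adjoint z) - T (T.adjoint w)‖ := by
    intro z w hz hw
    rw [mem_closedBall_zero_iff] at hz hw
    have h1 : ‖z - w‖ ≤ 2 := (norm_sub_le _ _).trans (by linarith)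
    calc ‖T.adjoint z - T.adjoint w‖ ^ 2
        = ‖⟪T.adjoint (z - w), T.adjoint (z - w)⟫_𝕜‖ := by
          rw [inner_self_eq_norm_sq_to_K, map_sub]; simp
      _ = ‖⟪z - w, T (T.adjoint z) - T (T.adjoint w)⟫_𝕜‖ := by
          rw [ContinuousLinearMap.adjoint_inner_left, map_sub, map_sub]
      _ ≤ ‖z - w‖ * ‖T (T.adjoint z) - T (T.adjoint w)‖ := norm_inner_le_norm _ _
      _ ≤ _ := by gcongr
  have htb : TotallyBounded (T.comp T.adjoint '' Metric.closedBall 0 1) := by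
    obtain ⟨Q, hQ, hsub⟩ := hc.image_closedBall_subset_compact 1
    exact hQ.totallyBounded.subset hsub
  have htb' : TotallyBounded (T.adjoint '' Metric.closedBall 0 1) := by
    rw [Metric.totallyBounded_iff]
    intro ε hε
    obtain ⟨t, hts, htf, hcov⟩ := totallyBounded_iff_subset.1 htb _
      (Metric.dist_mem_uniformity (show 0 < ε ^ 2 / 2 by positivity))
    have hts' : ∀ y ∈ t, ∃ z, z ∈ Metric.closedBall (0 : F) 1 ∧ T (T.adjoint z) = y :=
      fun y hy => hts hy
    choose! g hgb hg using hts'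
    refine ⟨(T.adjoint ∘ g) '' t, htf.image _, ?_⟩
    rintro _ ⟨z, hz, rfl⟩
    obtain ⟨y, hy, hzy⟩ := Set.mem_iUnion₂.1 (hcov ⟨z, hz, rfl⟩)
    refine Set.mem_iUnion₂.2 ⟨_, ⟨y, hy, rfl⟩, ?_⟩
    have hzy : dist (T (T.adjoint z)) y < ε ^ 2 / 2 := hzy
    have hgy : T (T.adjoint (g y)) = y := hg y hy
    rw [← hgy, dist_eq_norm] at hzy
    rw [Metric.mem_ball, dist_eq_norm]
    refine lt_of_pow_lt_pow_left₀ 2 hε.le ((key z (g y) hz (hgb y hy)).trans_lt ?_)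
    linarith
  refine (isCompactOperator_iff_image_closedBall_subset_compact (T.adjoint : F →ₗ[𝕜] E)
    one_pos).2 ?_
  exact ⟨_, htb'.closure.isCompact_of_isClosed isClosed_closure, subset_closure⟩

end CompactAdjoint

/-! ### The difference of the two observation maps and its compactness. -/

namespace Control

variable {𝕜 H U : Type*} [RCLike 𝕜] [NormedAddCommGroup H] [InnerProductSpace 𝕜 H] [CompleteSpace H]
  [NormedAddCommGroup U] [InnerProductSpace 𝕜 U] [CompleteSpace U]
  [NormedSpace ℝ H] [IsScalarTower ℝ 𝕜 H]

/-- The right shift by `s` on `L²(0, T; U)`. -/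
noncomputable def delay (𝕜 : Type*) [RCLike 𝕜] {U : Type*} [NormedAddCommGroup U]
    [InnerProductSpace 𝕜 U] [CompleteSpace U] (T s : ℝ) : TimeL2 U T →L[𝕜] TimeL2 U T :=
  (LpToLpRestrictCLM ℝ U 𝕜 volume 2 (Set.Ioc 0 T)).comp
    ((Lp.compMeasurePreservingₗᵢ 𝕜 (fun r => r - s)
      (measurePreserving_sub_right volume s)).toContinuousLinearMap.comp
      (LpToLpRestrictCLM ℝ U 𝕜 volume 2 (Set.Ioc 0 T)).adjoint)

/-- In `delay`, extension by zero is taken as the adjoint of restriction, so that linearity and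
boundedness come for free; this lemma recovers its pointwise form. -/
theorem restrict_adjoint_ae {T : ℝ} (v : TimeL2 U T) {φ : ℝ → U}
    (hφ : v =ᵐ[volume.restrict (Set.Ioc 0 T)] φ) :
    (LpToLpRestrictCLM ℝ U 𝕜 volume 2 (Set.Ioc 0 T)).adjoint v =ᵐ[volume]
      (Set.Ioc 0 T).indicator φ := by
  have hm : MemLp ((Set.Ioc 0 T).indicator φ) 2 volume :=
    (memLp_indicator_iff_restrict measurableSet_Ioc).2 ((memLp_congr_ae hφ).1 (Lp.memLp v))
  have : (LpToLpRestrictCLM ℝ U 𝕜 volume 2 (Set.Ioc 0 T)).adjoint v = hm.toLp _ := by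
    refine ext_inner_left 𝕜 fun w => ?_
    rw [ContinuousLinearMap.adjoint_inner_right, L2.inner_def, L2.inner_def]
    have h1 : ∫ r, ⟪w r, (hm.toLp _) r⟫_𝕜 =
        ∫ r, (Set.Ioc 0 T).indicator (fun r => ⟪w r, φ r⟫_𝕜) r := by
      refine integral_congr_ae ?_
      filter_upwards [hm.coeFn_toLp] with r hr
      rw [hr]
      by_cases h : r ∈ Set.Ioc 0 T
      · simp only [Set.indicator_of_mem h]
      · simp only [Set.indicator_of_notMem h, inner_zero_right]
    rw [h1, integral_indicator measurableSet_Ioc]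
    refine integral_congr_ae ?_
    filter_upwards [hφ, LpToLpRestrictCLM_coeFn 𝕜 (Set.Ioc 0 T) w] with r h2 h3
    rw [h2, h3]
  rw [this]
  exact hm.coeFn_toLp

theorem delay_ae {T : ℝ} (s : ℝ) (v : TimeL2 U T) {φ : ℝ → U}
    (hφ : v =ᵐ[volume.restrict (Set.Ioc 0 T)] φ) :
    delay 𝕜 T s v =ᵐ[volume.restrict (Set.Ioc 0 T)]
      fun r => (Set.Ioc 0 T).indicator φ (r - s) := by
  have hmp : MeasurePreserving (fun r : ℝ => r - s) volume volume :=
    measurePreserving_sub_right volume s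
  refine (LpToLpRestrictCLM_coeFn 𝕜 _ _).trans (ae_restrict_of_ae ?_)
  refine (Lp.coeFn_compMeasurePreserving _ hmp).trans ?_
  exact hmp.quasiMeasurePreserving.ae (restrict_adjoint_ae (𝕜 := 𝕜) v hφ)

theorem continuous_delay {Y : Type*} [TopologicalSpace Y] {T : ℝ} {s : Y → ℝ} {v : Y → TimeL2 U T}
    (hs : Continuous s) (hv : Continuous v) : Continuous fun y => delay 𝕜 T (s y) (v y) := by
  refine (LpToLpRestrictCLM ℝ U 𝕜 volume 2 (Set.Ioc 0 T)).continuous.comp ?_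
  let F : C(ℝ × ℝ, ℝ) := ⟨fun p => p.2 - p.1, by fun_prop⟩
  exact Continuous.compMeasurePreservingLp
    (f := fun y => (LpToLpRestrictCLM ℝ U 𝕜 volume 2 (Set.Ioc 0 T)).adjoint (v y))
    (g := fun y => F.curry (s y)) (by fun_prop) (F.curry.continuous.comp hs)
    (fun y => measurePreserving_sub_right volume (s y)) (by simp)

variable {A : H →ₗ.[𝕜] H} {S S₁ : C0Semigroup 𝕜 H} {K : H →L[𝕜] H}

/-- Taking adjoints and reversing time in the integral puts the unperturbed semigroup outermost,
where `B*` meets the known observation map of `A`. -/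
theorem perturb_adjoint_apply_eq_add_integral (h : IsGenerator A S)
    (h₁ : IsGenerator (perturb A K) S₁) {t : ℝ} (ht : 0 ≤ t) (z : H) :
    (S₁.toFun t.toNNReal).adjoint z = (S.toFun t.toNNReal).adjoint z +
      ∫ s in (0 : ℝ)..t, (S.toFun (t - s).toNNReal).adjoint
        (K.adjoint ((S₁.toFun s.toNNReal).adjoint z)) := by
  refine ext_inner_left 𝕜 fun x => ?_
  have c1 : Continuous fun s : ℝ => S₁.toFun (t - s).toNNReal (K (S.toFun s.toNNReal x)) :=
    S₁.continuous_comp (by fun_prop) (K.continuous.comp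
      (S.continuous_comp continuous_id continuous_const))
  have c2 : Continuous fun s : ℝ => (S.toFun (t - s).toNNReal).adjoint
        (K.adjoint ((S₁.toFun s.toNNReal).adjoint z)) :=
    S.adjoint.continuous_comp (by fun_prop) (K.adjoint.continuous.comp
      (S₁.adjoint.continuous_comp continuous_id continuous_const))
  rw [ContinuousLinearMap.adjoint_inner_right, perturb_apply_eq_add_integral h h₁ ht,
    inner_add_left, inner_add_right, inner_intervalIntegral_left c1,
    inner_intervalIntegral_right c2, ContinuousLinearMap.adjoint_inner_right]
  congr 1
  have h1 := intervalIntegral.integral_comp_sub_left (a := 0) (b := t)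
    (fun s : ℝ => ⟪S₁.toFun (t - s).toNNReal (K (S.toFun s.toNNReal x)), z⟫_𝕜) t
  simp only [sub_sub_cancel, sub_self, sub_zero] at h1
  rw [← h1]
  simp only [ContinuousLinearMap.adjoint_inner_right]

theorem dual_perturb (B : ControlOp A U) (z : AdjDom (perturb A K)) :
    ControlOp.dual (ControlOp.perturb B K) z = ControlOp.dual B (adjDomInclusion A K z) := by
  refine ext_inner_right 𝕜 fun u => ?_
  rw [ControlOp.inner_dual, ControlOp.inner_dual, ControlOp.perturb_apply]

/-- The integrand of the difference of the observation maps of `A + K` and `A`. -/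
noncomputable def obsDiffIntegrand (h : IsGenerator A S) (S₁ : C0Semigroup 𝕜 H) (K : H →L[𝕜] H)
    (B : ControlOp A U) (T s : ℝ) : H →L[𝕜] TimeL2 U T :=
  (delay 𝕜 T s).comp ((obsCLM h B T).comp (K.adjoint.comp (S₁.toFun s.toNNReal).adjoint))

theorem continuous_obsDiffIntegrand (h : IsGenerator A S) (S₁ : C0Semigroup 𝕜 H) (K : H →L[𝕜] H)
    (B : ControlOp A U) (T : ℝ) (z : H) :
    Continuous fun s => obsDiffIntegrand h S₁ K B T s z :=
  continuous_delay continuous_id ((obsCLM h B T).continuous.comp (K.adjoint.continuous.comp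
    (S₁.adjoint.continuous_comp continuous_id continuous_const)))

variable [NormedSpace ℝ U] [IsScalarTower ℝ 𝕜 U]

/-- The difference of the observation maps of `A + K` and `A`. -/
noncomputable def obsDiff (h : IsGenerator A S) (S₁ : C0Semigroup 𝕜 H) (K : H →L[𝕜] H)
    (B : ControlOp A U) (T : ℝ) : H →L[𝕜] TimeL2 U T :=
  strongIntegral (obsDiffIntegrand h S₁ K B T) (continuous_obsDiffIntegrand h S₁ K B T) 0 T

/-- For `‖z‖ ≤ 1` and `s ∈ (0, T]`, the vectors `K* S₁(s)* z` stay in one compact set `Q`, so the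
integrand stays in the compact image `P` of `[0, T] × Q`. The integral is `T` times a mean value,
which lies in the compact closed convex hull of `P`. -/
theorem isCompactOperator_obsDiff (h : IsGenerator A S) (S₁ : C0Semigroup 𝕜 H)
    (hK : IsCompactOperator K) (B : ControlOp A U) {T : ℝ} (hT : 0 < T) :
    IsCompactOperator (obsDiff h S₁ K B T) := by
  obtain ⟨M, hM0, hM⟩ := S₁.adjoint.exists_bound_Icc 0 T
  obtain ⟨Q, hQ, hKQ⟩ := hK.adjoint.image_closedBall_subset_compact M
  have hc : Continuous fun p : ℝ × H => delay 𝕜 T p.1 (obsCLM h B T p.2) :=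
    continuous_delay continuous_fst (by fun_prop)
  have hQ' := (isCompact_Icc.prod hQ).image hc (X := ℝ × H) (s := Set.Icc 0 T ×ˢ Q)
  set P := (fun p : ℝ × H => delay 𝕜 T p.1 (obsCLM h B T p.2)) '' (Set.Icc 0 T ×ˢ Q)
  have hP : IsCompact (closure (convexHull ℝ P)) :=
    (totallyBounded_convexHull.2 hQ'.totallyBounded).closure.isCompact_of_isClosed isClosed_closure
  refine (isCompactOperator_iff_image_closedBall_subset_compact
    (obsDiff h S₁ K B T : H →ₗ[𝕜] TimeL2 U T) one_pos).2 ?_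
  refine ⟨(fun v => T • v) '' closure (convexHull ℝ P), hP.image (continuous_const_smul T), ?_⟩
  rintro _ ⟨z, hz, rfl⟩
  rw [mem_closedBall_zero_iff] at hz
  have hmem : ⨍ s in Set.Ioc 0 T, obsDiffIntegrand h S₁ K B T s z ∈ closure (convexHull ℝ P) := by
    refine (convex_convexHull ℝ P).closure.set_average_mem isClosed_closure (by simp [hT])
      (by simp) ?_ ?_
    · filter_upwards [ae_restrict_mem measurableSet_Ioc] with s hs
      refine subset_closure (subset_convexHull ℝ P ⟨(s, _), ⟨⟨hs.1.le, hs.2⟩, hKQ ⟨_, ?_, rfl⟩⟩, rfl⟩)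
      rw [mem_closedBall_zero_iff]
      refine ((S₁.adjoint.toFun _).le_opNorm z).trans ?_
      exact (mul_le_of_le_one_right (norm_nonneg _) hz).trans (hM s ⟨hs.1.le, hs.2⟩)
    · exact (continuous_obsDiffIntegrand h S₁ K B T z).integrableOn_Ioc
  refine ⟨_, hmem, ?_⟩
  have : T * T⁻¹ = 1 := mul_inv_cancel₀ hT.ne'
  simp only [setAverage_eq, Real.volume_real_Ioc_of_le hT.le,
    sub_zero, smul_smul, this, one_smul]
  exact (intervalIntegral.integral_of_le hT.le).symm

end Control

/-! ### The regularized identity for the difference. -/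

namespace Control

variable {𝕜 H U : Type*} [RCLike 𝕜] [NormedAddCommGroup H] [InnerProductSpace 𝕜 H] [CompleteSpace H]
  [NormedAddCommGroup U] [InnerProductSpace 𝕜 U] [CompleteSpace U]
  [NormedSpace ℝ H] [IsScalarTower ℝ 𝕜 H] [NormedSpace ℝ U] [IsScalarTower ℝ 𝕜 U]

theorem integral_Ioc_indicator_sub {E : Type*} [NormedAddCommGroup E] [NormedSpace ℝ E] {T r : ℝ}
    (hr : r ∈ Set.Ioc 0 T) (φ : ℝ → ℝ → E) :
    ∫ s in Set.Ioc 0 T, (Set.Ioc 0 T).indicator (fun q => φ q s) (r - s) =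
      ∫ s in (0 : ℝ)..r, φ (r - s) s := by
  have h2 : Set.Ioo 0 r = Set.Ioc 0 T ∩ Set.Iio r := by
    ext s
    simp only [Set.mem_Ioo, Set.mem_inter_iff, Set.mem_Ioc, Set.mem_Iio]
    constructor
    · rintro ⟨a, b⟩
      exact ⟨⟨a, b.le.trans hr.2⟩, b⟩
    · rintro ⟨⟨a, -⟩, b⟩
      exact ⟨a, b⟩
  rw [intervalIntegral.integral_of_le hr.1.le, ← restrict_Ioo_eq_restrict_Ioc (b := r), h2,
    ← setIntegral_indicator measurableSet_Iio]
  refine setIntegral_congr_fun measurableSet_Ioc fun s hs => ?_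
  by_cases hsr : s < r
  · simp only [Set.indicator_of_mem (show r - s ∈ Set.Ioc 0 T from
      ⟨sub_pos.2 hsr, by linarith [hs.1, hr.2]⟩), Set.indicator_of_mem (show s ∈ Set.Iio r from hsr)]
  · simp only [Set.indicator_of_notMem (fun hm : r - s ∈ Set.Ioc 0 T => hsr (sub_pos.1 hm.1)),
      Set.indicator_of_notMem (show s ∉ Set.Iio r from hsr)]

/-- Fubini's theorem for the pairing of a convolution with a square integrable function. -/
theorem integral_inner_indicator_swap {T : ℝ} (f : TimeL2 U T) {φ : ℝ → ℝ → U}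
    (hφ : Continuous fun p : ℝ × ℝ => φ p.1 p.2) :
    ∫ s in Set.Ioc 0 T, ∫ r in Set.Ioc 0 T,
        ⟪f r, (Set.Ioc 0 T).indicator (fun q => φ q s) (r - s)⟫_𝕜 =
      ∫ r in Set.Ioc 0 T, ⟪f r, ∫ s in (0 : ℝ)..r, φ (r - s) s⟫_𝕜 := by
  have hψ : Continuous fun p : ℝ × ℝ => φ (p.2 - p.1) p.1 :=
    hφ.comp ((continuous_snd.sub continuous_fst).prodMk continuous_fst)
  obtain ⟨C, hC⟩ := (isCompact_Icc.prod isCompact_Icc).exists_bound_of_continuousOn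
    (hψ.continuousOn (s := Set.Icc 0 T ×ˢ Set.Icc 0 T))
  have hS : MeasurableSet {p : ℝ × ℝ | p.2 - p.1 ∈ Set.Ioc 0 T} :=
    (measurable_snd.sub measurable_fst) measurableSet_Ioc
  have e : ∀ s r, (Set.Ioc 0 T).indicator (fun q => φ q s) (r - s) =
      {p : ℝ × ℝ | p.2 - p.1 ∈ Set.Ioc 0 T}.indicator (fun p => φ (p.2 - p.1) p.1) (s, r) := by
    intro s r
    by_cases h : r - s ∈ Set.Ioc 0 T
    · rw [Set.indicator_of_mem h, Set.indicator_of_mem (show (s, r) ∈ {p : ℝ × ℝ | p.2 - p.1 ∈ Set.Ioc 0 T} from h)]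
    · rw [Set.indicator_of_notMem h, Set.indicator_of_notMem (show (s, r) ∉ {p : ℝ × ℝ | p.2 - p.1 ∈ Set.Ioc 0 T} from h)]
  have hint : Integrable (Function.uncurry fun s r : ℝ =>
      ⟪f r, (Set.Ioc 0 T).indicator (fun q => φ q s) (r - s)⟫_𝕜)
      ((volume.restrict (Set.Ioc 0 T)).prod (volume.restrict (Set.Ioc 0 T))) := by
    have hf : Integrable (fun r => ‖f r‖ * max C 0) (volume.restrict (Set.Ioc 0 T)) :=
      (((Lp.memLp f).integrable one_le_two).norm).mul_const _
    refine (hf.comp_snd (volume.restrict (Set.Ioc 0 T))).mono' ?_ ?_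
    · have h1 : AEStronglyMeasurable (fun p : ℝ × ℝ => f p.2)
          ((volume.restrict (Set.Ioc 0 T)).prod (volume.restrict (Set.Ioc 0 T))) :=
        (Lp.aestronglyMeasurable f).comp_snd
      simp only [Function.uncurry_def, e]
      exact h1.inner (hψ.stronglyMeasurable.indicator hS).aestronglyMeasurable
    · have h2 : ∀ᵐ p ∂((volume.restrict (Set.Ioc 0 T)).prod (volume.restrict (Set.Ioc 0 T))),
          p ∈ Set.Ioc 0 T ×ˢ Set.Ioc 0 T := by
        rw [Measure.prod_restrict]
        exact ae_restrict_mem (measurableSet_Ioc.prod measurableSet_Ioc)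
      filter_upwards [h2] with p hp
      refine (norm_inner_le_norm _ _).trans ?_
      gcongr
      rw [e]
      refine (norm_indicator_le_norm_self _ _).trans (le_max_of_le_left ?_)
      exact hC p ⟨⟨hp.1.1.le, hp.1.2⟩, ⟨hp.2.1.le, hp.2.2⟩⟩
  rw [integral_integral_swap hint]
  refine setIntegral_congr_fun measurableSet_Ioc fun r hr => ?_
  have hc : Continuous fun s => φ (r - s) s := by
    exact hψ.comp (continuous_id.prodMk continuous_const)
  rw [inner_intervalIntegral_right hc, ← integral_Ioc_indicator_sub hr fun q s => ⟪f r, φ q s⟫_𝕜]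
  refine setIntegral_congr_fun measurableSet_Ioc fun s _ => ?_
  by_cases h : r - s ∈ Set.Ioc 0 T
  · simp only [Set.indicator_of_mem h]
  · simp only [Set.indicator_of_notMem h, inner_zero_right]

variable {A : H →ₗ.[𝕜] H} {S S₁ : C0Semigroup 𝕜 H} {K : H →L[𝕜] H}

/-- The difference `S₁(t)* z - S(t)* z` in `D(A*)`. -/
noncomputable def flowDiff (h : IsGenerator A S) (h₁ : IsGenerator (perturb A K) S₁)
    (z : AdjDom (perturb A K)) (t : ℝ) : AdjDom A :=
  adjDomInclusion A K (adjFlow h₁ t.toNNReal z) - adjFlow h t.toNNReal (adjDomInclusion A K z)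

theorem continuous_flowDiff (h : IsGenerator A S) (h₁ : IsGenerator (perturb A K) S₁)
    (z : AdjDom (perturb A K)) : Continuous (flowDiff h h₁ z) :=
  ((adjDomInclusion A K).continuous.comp (continuous_adjFlow h₁ z)).sub (continuous_adjFlow h _)

theorem dual_flowDiff (h : IsGenerator A S) (h₁ : IsGenerator (perturb A K) S₁) (B : ControlOp A U)
    (z : AdjDom (perturb A K)) (t : ℝ) : ControlOp.dual B (flowDiff h h₁ z t) =
      observe h₁ (ControlOp.perturb B K) z t - observe h B (adjDomInclusion A K z) t := by
  rw [flowDiff, map_sub, observe, observe, dual_perturb]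

theorem flowDiff_fst (h : IsGenerator A S) (h₁ : IsGenerator (perturb A K) S₁)
    (z : AdjDom (perturb A K)) {t : ℝ} (ht : 0 ≤ t) :
    (flowDiff h h₁ z t).1.1 = ∫ s in (0 : ℝ)..t, (S.toFun (t - s).toNNReal).adjoint
        (K.adjoint ((S₁.toFun s.toNNReal).adjoint z.1.1)) := by
  change (S₁.toFun t.toNNReal).adjoint z.1.1 - (S.toFun t.toNNReal).adjoint z.1.1 = _
  rw [perturb_adjoint_apply_eq_add_integral h h₁ ht, add_sub_cancel_left]

/-- The regularized identity for the difference of the observation maps. -/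
theorem integral_inner_delay_avg {h : IsGenerator A S} (h₁ : IsGenerator (perturb A K) S₁)
    {B : ControlOp A U} (hB : IsAdmissible h B) {T : ℝ} (hT : 0 < T) {ε : ℝ} (hε : 0 < ε)
    (f : TimeL2 U T) (z : AdjDom (perturb A K)) :
    ∫ s in (0 : ℝ)..T, ⟪f, delay 𝕜 T s (obsCLM h B T ((S.avg ε).adjoint
        (K.adjoint ((S₁.toFun s.toNNReal).adjoint z.1.1))))⟫_𝕜 =
      ∫ r in Set.Ioc 0 T, ⟪f r, ControlOp.dual B (avgLift h hε (flowDiff h h₁ z r).1.1)⟫_𝕜 := by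
  -- After averaging, `B*` is the bounded operator `L` on all of `H`, so it commutes with integrals.
  set L := (ControlOp.dual B).comp (avgLift h hε)
  set v : ℝ → H := fun s => K.adjoint ((S₁.toFun s.toNNReal).adjoint z.1.1)
  have hv : Continuous v :=
    K.adjoint.continuous.comp (S₁.adjoint.continuous_comp continuous_id continuous_const)
  have hφ : Continuous fun p : ℝ × ℝ => L ((S.toFun p.1.toNNReal).adjoint (v p.2)) :=
    L.continuous.comp (S.adjoint.continuous_comp continuous_fst (hv.comp continuous_snd))
  have hswap := integral_inner_indicator_swap (𝕜 := 𝕜) f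
    (φ := fun q s => L ((S.toFun q.toNNReal).adjoint (v s))) hφ
  rw [intervalIntegral.integral_of_le hT.le]
  refine Eq.trans ?_ (hswap.trans ?_)
  · refine setIntegral_congr_fun measurableSet_Ioc fun s _ => ?_
    rw [L2.inner_def]
    refine integral_congr_ae ?_
    have h2 : obsCLM h B T ((S.avg ε).adjoint (v s)) =ᵐ[volume.restrict (Set.Ioc 0 T)]
        fun q => L ((S.toFun q.toNNReal).adjoint (v s)) := by
      rw [← avgLift_fst h hε, obsCLM_apply hB hT]
      refine (observeLin_ae h B T _).trans (ae_of_all _ fun q => ?_)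
      exact observe_avgLift h B hε (v s) q
    filter_upwards [delay_ae (𝕜 := 𝕜) s _ h2] with r hr
    rw [hr]
  · refine setIntegral_congr_fun measurableSet_Ioc fun r hr => ?_
    rw [flowDiff_fst h h₁ z hr.1.le]
    congr 1
    exact L.intervalIntegral_comp_comm (Continuous.intervalIntegrable
      (S.adjoint.continuous_comp (by fun_prop) hv) _ _)

end Control

/-! ### Surjectivity, lower bounds and compact perturbations. -/

/-- A surjective bounded operator between Hilbert spaces has an adjoint bounded from below. -/
theorem ContinuousLinearMap.exists_norm_le_of_surjective_adjoint {𝕜 E F : Type*} [RCLike 𝕜]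
    [NormedAddCommGroup E] [InnerProductSpace 𝕜 E] [CompleteSpace E]
    [NormedAddCommGroup F] [InnerProductSpace 𝕜 F] [CompleteSpace F] (P : E →L[𝕜] F)
    (hP : Function.Surjective P.adjoint) : ∃ C : ℝ, 0 < C ∧ ∀ z, ‖z‖ ≤ C * ‖P z‖ := by
  -- The open mapping theorem gives preimages `x` of `z` under `P*` with `‖x‖ ≤ C ‖z‖`; pairing `z`
  -- with `P* x = z` then bounds `‖z‖²`.
  obtain ⟨C, hC0, hC⟩ := P.adjoint.exists_preimage_norm_le hP
  refine ⟨C, hC0, fun z => ?_⟩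
  obtain ⟨x, hx, hxC⟩ := hC z
  rcases (norm_nonneg z).eq_or_lt with h0 | hpos
  · rw [← h0]; positivity
  refine le_of_mul_le_mul_right ?_ hpos
  calc ‖z‖ * ‖z‖ = ‖⟪z, P.adjoint x⟫_𝕜‖ := by
        rw [hx, inner_self_eq_norm_sq_to_K]; simp [sq]
    _ = ‖⟪P z, x⟫_𝕜‖ := by rw [ContinuousLinearMap.adjoint_inner_right]
    _ ≤ ‖P z‖ * ‖x‖ := norm_inner_le_norm _ _
    _ ≤ ‖P z‖ * (C * ‖z‖) := by gcongr
    _ = _ := by ring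

/-- The adjoint of a bounded operator bounded from below is surjective. -/
theorem ContinuousLinearMap.surjective_adjoint_of_norm_le {𝕜 E F : Type*} [RCLike 𝕜]
    [NormedAddCommGroup E] [InnerProductSpace 𝕜 E] [CompleteSpace E]
    [NormedAddCommGroup F] [InnerProductSpace 𝕜 F] [CompleteSpace F] (P : E →L[𝕜] F) {C : ℝ}
    (hC : 0 < C) (hP : ∀ z, ‖z‖ ≤ C * ‖P z‖) : Function.Surjective P.adjoint := by
  -- The lower bound makes `P* P` coercive, hence invertible, and `P (P* P)⁻¹ y` is a preimage of
  -- `y`.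
  have hunit : IsUnit (P.adjoint.comp P) := by
    refine isUnit_of_forall_le_norm_inner_map _ (c := ((C ^ 2)⁻¹).toNNReal)
      (Real.toNNReal_pos.2 (by positivity)) fun z => ?_
    rw [ContinuousLinearMap.comp_apply, ContinuousLinearMap.adjoint_inner_left,
      inner_self_eq_norm_sq_to_K]
    simp only [norm_pow, RCLike.norm_ofReal, abs_norm]
    rw [Real.coe_toNNReal _ (by positivity), ← div_eq_mul_inv, div_le_iff₀ (by positivity),
      mul_comm, ← mul_pow]
    gcongr
    exact hP z
  intro y
  obtain ⟨u, hu⟩ := hunit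
  refine ⟨P ((↑u⁻¹ : E →L[𝕜] E) y), ?_⟩
  have := congrArg (fun Q : E →L[𝕜] E => Q y) u.mul_inv
  rw [hu] at this
  exact this

/-- An injective compact perturbation of an operator bounded from below is bounded from below. -/
theorem ContinuousLinearMap.exists_norm_le_add_of_isCompactOperator {𝕜 E F : Type*} [RCLike 𝕜]
    [NormedAddCommGroup E] [NormedSpace 𝕜 E] [CompleteSpace E]
    [NormedAddCommGroup F] [NormedSpace 𝕜 F] (P D : E →L[𝕜] F) (hD : IsCompactOperator D)
    {C : ℝ} (hP : ∀ z, ‖z‖ ≤ C * ‖P z‖) (hinj : ∀ z, P z + D z = 0 → z = 0) :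
    ∃ C' : ℝ, 0 < C' ∧ ∀ z, ‖z‖ ≤ C' * ‖P z + D z‖ := by
  by_contra! hcon
  -- Normalizing gives unit vectors `w n` with `(P + D)(w n) → 0`. Along a subsequence `D w`
  -- converges, hence so does `P w`, and the lower bound for `P` makes `w` Cauchy. Its limit is a
  -- unit vector in the kernel of `P + D`.
  choose z hz using fun n : ℕ => hcon ((n : ℝ) + 1) (by positivity)
  have hz0 : ∀ n, z n ≠ 0 := fun n h => by
    have := hz n
    rw [h] at this
    simp at this
  set w : ℕ → E := fun n => ((‖z n‖⁻¹ : ℝ) : 𝕜) • z n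
  have hw1 : ∀ n, ‖w n‖ = 1 := fun n => by
    simp only [w, norm_smul, RCLike.norm_ofReal, abs_inv, abs_norm]
    exact inv_mul_cancel₀ (norm_ne_zero_iff.2 (hz0 n))
  have hlim : Tendsto (fun n => P (w n) + D (w n)) atTop (𝓝 0) := by
    refine squeeze_zero_norm (fun n => ?_) tendsto_one_div_add_atTop_nhds_zero_nat
    have hpos : 0 < ‖z n‖ := norm_pos_iff.2 (hz0 n)
    have : P (w n) + D (w n) = ((‖z n‖⁻¹ : ℝ) : 𝕜) • (P (z n) + D (z n)) := by
      simp only [w, map_smul, smul_add]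
    rw [this, norm_smul, RCLike.norm_ofReal, abs_inv, abs_norm, le_div_iff₀ (by positivity),
      mul_assoc, inv_mul_le_iff₀ hpos, mul_one, mul_comm]
    exact (hz n).le
  obtain ⟨Q, hQ, hsub⟩ := hD.image_closedBall_subset_compact 1
  obtain ⟨y, -, φ, hφ, hy⟩ := hQ.tendsto_subseq (x := fun n => D (w n)) fun n =>
    hsub ⟨w n, by rw [mem_closedBall_zero_iff, hw1], rfl⟩
  have hP' : Tendsto (fun n => P (w (φ n))) atTop (𝓝 (0 - y)) := by
    refine ((hlim.comp hφ.tendsto_atTop).sub hy).congr fun n => ?_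
    simp
  have hC0 : 0 < C := by
    by_contra! h
    have := (hP (w 0)).trans (mul_nonpos_of_nonpos_of_nonneg h (norm_nonneg _))
    rw [hw1] at this
    linarith
  have hcau : CauchySeq fun n => w (φ n) := by
    rw [Metric.cauchySeq_iff]
    intro ε hε
    obtain ⟨N, hN⟩ := Metric.cauchySeq_iff.1 hP'.cauchySeq (ε / C) (by positivity)
    refine ⟨N, fun m hm n hn => ?_⟩
    have := hN m hm n hn
    rw [dist_eq_norm, ← map_sub, lt_div_iff₀ hC0, mul_comm] at this
    rw [dist_eq_norm]
    exact (hP _).trans_lt this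
  obtain ⟨x, hx⟩ := cauchySeq_tendsto_of_complete hcau
  have hx1 : ‖x‖ = 1 := by
    have := hx.norm
    simp only [hw1] at this
    exact (tendsto_nhds_unique tendsto_const_nhds this).symm
  have hx0 : P x + D x = 0 := by
    refine tendsto_nhds_unique ?_ (hlim.comp hφ.tendsto_atTop)
    exact ((P.continuous.tendsto x).comp hx).add ((D.continuous.tendsto x).comp hx)
  rw [hinj x hx0, norm_zero] at hx1
  exact zero_ne_one hx1

/-! ### Removal of the regularization and conclusion. -/

namespace Control

variable {𝕜 H U : Type*} [RCLike 𝕜] [NormedAddCommGroup H] [InnerProductSpace 𝕜 H] [CompleteSpace H]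
  [NormedAddCommGroup U] [InnerProductSpace 𝕜 U] [CompleteSpace U]
  [NormedSpace ℝ H] [IsScalarTower ℝ 𝕜 H] [NormedSpace ℝ U] [IsScalarTower ℝ 𝕜 U]
  {A : H →ₗ.[𝕜] H} {S S₁ : C0Semigroup 𝕜 H} {K : H →L[𝕜] H}

theorem tendsto_integral_delay_avg (h : IsGenerator A S) (S₁ : C0Semigroup 𝕜 H) (K : H →L[𝕜] H)
    (B : ControlOp A U) {T : ℝ} (hT : 0 < T) (f : TimeL2 U T) (z : H) :
    Tendsto (fun n : ℕ => ∫ s in (0 : ℝ)..T, ⟪f, delay 𝕜 T s (obsCLM h B T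
        ((S.avg (1 / ((n : ℝ) + 1))).adjoint (K.adjoint ((S₁.toFun s.toNNReal).adjoint z))))⟫_𝕜)
      atTop (𝓝 ⟪f, obsDiff h S₁ K B T z⟫_𝕜) := by
  set v : ℝ → H := fun s => K.adjoint ((S₁.toFun s.toNNReal).adjoint z)
  have hv : Continuous v :=
    K.adjoint.continuous.comp (S₁.adjoint.continuous_comp continuous_id continuous_const)
  obtain ⟨M, hM0, hM⟩ := exists_norm_adjoint_avg_le S
  obtain ⟨C₁, hC₁0, hC₁⟩ := exists_opNorm_bound_of_isCompact
    (G := fun s : ℝ => (delay 𝕜 T s).comp (obsCLM h B T))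
    (fun x => continuous_delay continuous_id continuous_const) (isCompact_Icc (a := 0) (b := T))
  obtain ⟨C₂, hC₂⟩ := isCompact_Icc.exists_bound_of_continuousOn
    (hv.continuousOn (s := Set.Icc 0 T))
  have hc : ∀ L : H →L[𝕜] H, Continuous fun s => ⟪f, delay 𝕜 T s (obsCLM h B T (L (v s)))⟫_𝕜 :=
    fun L => continuous_const.inner (continuous_delay continuous_id (by fun_prop))
  have e : ⟪f, obsDiff h S₁ K B T z⟫_𝕜 =
      ∫ s in (0 : ℝ)..T, ⟪f, delay 𝕜 T s (obsCLM h B T (v s))⟫_𝕜 :=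
    inner_intervalIntegral_right (continuous_obsDiffIntegrand h S₁ K B T z) 0 T f
  rw [e]
  refine intervalIntegral.tendsto_integral_filter_of_dominated_convergence
    (fun _ => ‖f‖ * (C₁ * (M * C₂))) ?_ ?_ intervalIntegrable_const ?_
  · exact Eventually.of_forall fun n => (hc _).aestronglyMeasurable.restrict
  · refine Eventually.of_forall fun n => ae_of_all _ fun s hs => ?_
    rw [Set.uIoc_of_le hT.le] at hs
    have hs' : s ∈ Set.Icc 0 T := ⟨hs.1.le, hs.2⟩
    refine (norm_inner_le_norm _ _).trans ?_
    gcongr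
    refine (((delay 𝕜 T s).comp (obsCLM h B T)).le_of_opNorm_le (hC₁ s hs') _).trans ?_
    gcongr
    refine (hM n _).trans ?_
    gcongr
    exact hC₂ s hs'
  · refine ae_of_all _ fun s _ => ?_
    have hcont : Continuous fun x => ⟪f, delay 𝕜 T s (obsCLM h B T x)⟫_𝕜 := by fun_prop
    exact (hcont.tendsto _).comp (tendsto_adjoint_avg S (v s))

/-- Because `ψ` takes values in `D(A*)`, its regularizations converge in the graph norm and `B*`
passes to the limit; the graph-norm bound on the averages gives domination. -/
theorem tendsto_integral_dual_avgLift (h : IsGenerator A S) (B : ControlOp A U) {T : ℝ}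
    (f : TimeL2 U T) {ψ : ℝ → AdjDom A} (hψ : Continuous ψ) :
    Tendsto (fun n : ℕ => ∫ r in Set.Ioc 0 T, ⟪f r, ControlOp.dual B
        (avgLift h (Nat.one_div_pos_of_nat (α := ℝ) (n := n)) (ψ r).1.1)⟫_𝕜)
      atTop (𝓝 (∫ r in Set.Ioc 0 T, ⟪f r, ControlOp.dual B (ψ r)⟫_𝕜)) := by
  obtain ⟨M, hM0, hM⟩ := exists_norm_adjoint_avg_le S
  obtain ⟨C, hC⟩ := isCompact_Icc.exists_bound_of_continuousOn (hψ.continuousOn (s := Set.Icc 0 T))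
  have hf : Integrable (fun r => ‖f r‖ * (‖ControlOp.dual B‖ * (M * C)))
      (volume.restrict (Set.Ioc 0 T)) :=
    (((Lp.memLp f).integrable one_le_two).norm).mul_const _
  refine tendsto_integral_of_dominated_convergence _ (fun n => ?_) hf (fun n => ?_) ?_
  · refine (Lp.aestronglyMeasurable f).inner (Continuous.aestronglyMeasurable ?_)
    have : Continuous fun r => (ψ r).1.1 := continuous_fst.comp (continuous_subtype_val.comp hψ)
    fun_prop
  · filter_upwards [ae_restrict_mem measurableSet_Ioc] with r hr
    refine (norm_inner_le_norm _ _).trans ?_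
    gcongr
    refine ((ControlOp.dual B).le_opNorm _).trans ?_
    gcongr
    refine (norm_avgLift_le h hM0.le hM n _).trans ?_
    gcongr
    exact hC r ⟨hr.1.le, hr.2⟩
  · refine ae_of_all _ fun r => ?_
    have hcont : Continuous fun x => ⟪f r, ControlOp.dual B x⟫_𝕜 := by fun_prop
    exact (hcont.tendsto _).comp (tendsto_avgLift h (ψ r))

/-- The observation map of `A + K` in terms of the one of `A`. -/
theorem observeLin_perturb {h : IsGenerator A S} (h₁ : IsGenerator (perturb A K) S₁)
    {B : ControlOp A U} (hB : IsAdmissible h B) {T : ℝ} (hT : 0 < T) (z : AdjDom (perturb A K)) :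
    observeLin h₁ (ControlOp.perturb B K) T z = obsCLM h B T z.1.1 + obsDiff h S₁ K B T z.1.1 := by
  have hz : obsCLM h B T z.1.1 = observeLin h B T (adjDomInclusion A K z) :=
    obsCLM_apply hB hT (adjDomInclusion A K z)
  rw [hz, ← sub_eq_iff_eq_add']
  refine ext_inner_left 𝕜 fun f => ?_
  have h1 := tendsto_integral_delay_avg h S₁ K B hT f z.1.1
  have h2 := tendsto_integral_dual_avgLift h B f (continuous_flowDiff h h₁ z)
  -- Both sequences agree for each `n` by the regularized identity, so their limits, the two sides
  -- of the weak formulation, coincide.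
  have h3 := tendsto_nhds_unique (h1.congr fun n =>
    integral_inner_delay_avg h₁ hB hT Nat.one_div_pos_of_nat f z) h2
  rw [h3, L2.inner_def]
  refine integral_congr_ae ?_
  filter_upwards [Lp.coeFn_sub (observeLin h₁ (ControlOp.perturb B K) T z)
    (observeLin h B T (adjDomInclusion A K z)), observeLin_ae h₁ (ControlOp.perturb B K) T z,
    observeLin_ae h B T (adjDomInclusion A K z)] with r hr h4 h5
  rw [hr, dual_flowDiff, Pi.sub_apply, h4, h5]

theorem IsAdmissible.perturb {h : IsGenerator A S} (h₁ : IsGenerator (perturb A K) S₁)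
    {B : ControlOp A U} (hB : IsAdmissible h B) :
    IsAdmissible h₁ (ControlOp.perturb B K) := by
  rw [isAdmissible_iff]
  intro T hT
  refine ⟨‖obsCLM h B T + obsDiff h S₁ K B T‖, fun z => ?_⟩
  rw [observeLin_perturb h₁ hB hT]
  exact (obsCLM h B T + obsDiff h S₁ K B T).le_opNorm _

theorem obsCLM_perturb {h : IsGenerator A S} (h₁ : IsGenerator (perturb A K) S₁)
    {B : ControlOp A U} (hB : IsAdmissible h B) {T : ℝ} (hT : 0 < T) :
    obsCLM h₁ (ControlOp.perturb B K) T = obsCLM h B T + obsDiff h S₁ K B T := by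
  refine ContinuousLinearMap.ext fun z => ?_
  refine congrFun (h₁.denseRange_adjDomFst.equalizer (by fun_prop) (by fun_prop) (funext fun z => ?_)) z
  exact (obsCLM_apply (hB.perturb h₁) hT z).trans (observeLin_perturb h₁ hB hT z)

theorem ApproximatelyControllable.exactlyControllable_perturb {h : IsGenerator A S}
    (h₁ : IsGenerator (perturb A K) S₁) {B : ControlOp A U} (hB : IsAdmissible h B)
    (hK : IsCompactOperator K) {T : ℝ} (hT : 0 < T) (hexact : ExactlyControllable h B T)
    (happ : ApproximatelyControllable h₁ (ControlOp.perturb B K) T) :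
    ExactlyControllable h₁ (ControlOp.perturb B K) T := by
  obtain ⟨C, hC0, hC⟩ := (obsCLM h B T).exists_norm_le_of_surjective_adjoint
    ((exactlyControllable_iff hB hT).1 hexact)
  have hB₁ : IsAdmissible h₁ (ControlOp.perturb B K) := hB.perturb h₁
  have hobs := obsCLM_perturb h₁ hB hT
  obtain ⟨C', hC'0, hC'⟩ := (obsCLM h B T).exists_norm_le_add_of_isCompactOperator
    (obsDiff h S₁ K B T) (isCompactOperator_obsDiff h S₁ hK B hT) hC fun z hz =>
      happ.eq_zero_of_obsCLM_eq_zero hB₁ hT (by rw [hobs]; exact hz)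
  rw [exactlyControllable_iff hB₁ hT]
  refine ContinuousLinearMap.surjective_adjoint_of_norm_le _ hC'0 fun z => ?_
  rw [hobs]
  exact hC' z

end Control

theorem mainTheorem2 {𝕜 H U : Type*} [RCLike 𝕜]
    [NormedAddCommGroup H] [InnerProductSpace 𝕜 H] [CompleteSpace H]
    [NormedAddCommGroup U] [InnerProductSpace 𝕜 U] [CompleteSpace U]
    (A₀ : H →ₗ.[𝕜] H) (S₀ : C0Semigroup 𝕜 H) (h₀ : Control.IsGenerator A₀ S₀)
    (B : Control.ControlOp A₀ U) (hB : Control.IsAdmissible h₀ B)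
    (K : H →L[𝕜] H) (hK : IsCompactOperator K)
    (T : ℝ) (hT : 0 < T) (hexact : Control.ExactlyControllable h₀ B T) :
    (∃ S : C0Semigroup 𝕜 H, Control.IsGenerator (Control.perturb A₀ K) S) ∧
    ∀ (S : C0Semigroup 𝕜 H) (h : Control.IsGenerator (Control.perturb A₀ K) S),
      Control.IsAdmissible h (Control.ControlOp.perturb B K) ∧
      (Control.ApproximatelyControllable h (Control.ControlOp.perturb B K) T →
        Control.ExactlyControllable h (Control.ControlOp.perturb B K) T) := by
  -- Bochner integration needs real scalars; restriction from `𝕜` supplies the real structures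
  -- assumed in the lemmas.
  let _ : NormedSpace ℝ H := NormedSpace.restrictScalars ℝ 𝕜 H
  have _ : IsScalarTower ℝ 𝕜 H := RestrictScalars.isScalarTower ℝ 𝕜 H
  let _ : NormedSpace ℝ U := NormedSpace.restrictScalars ℝ 𝕜 U
  have _ : IsScalarTower ℝ 𝕜 U := RestrictScalars.isScalarTower ℝ 𝕜 U
  exact ⟨h₀.exists_perturb K, fun S h => ⟨hB.perturb h, fun happ =>
    happ.exactlyControllable_perturb h hB hK hT hexact⟩⟩
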